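/- **Setting.** Let $F$ be a $\sigma$-finite measure on $\mathbb R$ whose natural parameter space $\{\xi\in\mathbb R:\int e^{\xi x}\,dF(x)<\infty\}$ is an open interval $\Omega=(\underline\xi,\bar\xi)$, $-\infty\le\underline\xi<\bar\xi\le\infty$. For $\xi\in\Omega$ put $b(\xi)=\log\int e^{\xi x}\,dF(x)$ and $f_\xi(x)=\exp(\xi x-b(\xi))$, a probability density with respect to $F$. Let $\mathbf P_\theta,\mathbf E_\theta$ refer to the law under which $X_1,X_2,\dots$ are i.i.d. with density $f_\theta$, and $\mathbf P^{(\nu)}_{\theta,\lambda},\mathbf E^{(\nu)}_{\theta,\lambda}$ to the law under which the $X_i$ are independent, $X_1,\dots,X_{\nu-1}$ have density $f_\theta$ and $X_\nu,X_{\nu+1},\dots$ have density $f_\lambda$. Assume $$\lim_{\theta\downarrow\underline\xi}\mathbf E_\theta X_1=-\infty ,$$ fix $\underline\xi<\theta_1<\lambda<\bar\xi$, and put $\Theta=(\underline\xi,\theta_1]$ and $I(\lambda,\theta)=\mathbf E_\lambda\log\big(f_\lambda(X_1)/f_\theta(X_1)\big)$. Stopping times take values in $\{0,1,2,\dots\}\cup\{\infty\}$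 and are taken with respect to the filtration $\sigma(X_1,\dots,X_n)$, $n\ge0$. For a stopping time $N$ let $$\bar{\mathbf E}_\lambda N=\sup_{\nu\ge1}\ \operatorname{ess\,sup}\ \mathbf E^{(\nu)}_{\theta',\lambda}\big[(N-\nu+1)^+\mid X_1,\dots,X_{\nu-1}\big],$$ where $\theta'\in\Theta$ is arbitrary (the value does not depend on it; all statements below hold for every choice of $\theta'$). For $a>0$ let $$\hat M(a)=\inf\Big\{n\ge1:\ \sum_{i=1}^n\log\frac{f_\lambda(X_i)}{f_\theta(X_i)}\ge I(\lambda,\theta)\,a\ \text{ for all }\theta\in\Theta\Big\},$$ let $\hat M_k(a)$ be $\hat M(a)$ applied to $X_k,X_{k+1},\dots$, and let $\hat M^*(a)=\min_{k\ge1}\big(\hat M_k(a)+k-1\big)$. **Theorem 2.3.** Each $\hat M^*(a)$, $a>0$, is a stopping time, and the following hold. 1. For all $a>0$ and $\theta\in\Theta$, $\ \mathbf E_\theta\hat M^*(a)\ge\exp(I(\lambda,\theta)a)$. 2. As $a\to\infty$, $\ \bar{\mathbf E}_\lambda\hat M^*(a)\le a+(\hat C+o(1))\sqrt a$, where $$\hat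 C=\frac{\lambda-\theta_1}{I(\lambda,\theta_1)}\sqrt{\frac{b''(\lambda)}{2\pi}}>0 .$$ 3. Let $\theta\in\Theta$. As $a\to\infty$, $$\frac{\log\mathbf E_\theta N}{I(\lambda,\theta)}\le a+(\hat C+o(1))\sqrt a$$ for all stopping times $N$ with $\bar{\mathbf E}_\lambda N\le\bar{\mathbf E}_\lambda\hat M^*(a)$, where the $o(1)$ term may depend on $\theta$ but not on $N$. In particular this holds with $N=N(a)$ for every family $\{N(a)\}$ of stopping times with $\bar{\mathbf E}_\lambda N(a)\le\bar{\mathbf E}_\lambda\hat M^*(a)$. 4. Consequently, for every $\theta\in\Theta$, $\hat M^*(a)$ asymptotically maximizes $\log\mathbf E_\theta N$ up to $O(\sqrt a)$ in this class: there is a constant $K$, depending on $\theta$ but not on $N$ or $a$, such that for all sufficiently large $a$, $\ \log\mathbf E_\theta N\le\log\mathbf E_\theta\hat M^*(a)+K\sqrt a$ for all stopping times $N$ with $\bar{\mathbf E}_\lambda N\le\bar{\mathbf E}_\lambda\hat M^*(a)$. -/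

import Mathlib

open MeasureTheory ProbabilityTheory Filter Topology
open scoped ENNReal

noncomputable section

namespace ExpFamilyChange

/-- A path of observations; the coordinate `ω i` is the observation `X_{i+1}`. -/
abbrev SamplePath : Type := ℕ → ℝ

/-- The log-normalizer `b(ξ) = log ∫ exp (ξ x) dF(x)`. -/
def logNorm (F : Measure ℝ) (ξ : ℝ) : ℝ := Real.log (∫ x, Real.exp (ξ * x) ∂F)

/-- The density `f_ξ(x) = exp (ξ x - b(ξ))` with respect to `F`. -/
def density (F : Measure ℝ) (ξ x : ℝ) : ℝ := Real.exp (ξ * x - logNorm F ξ)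

/-- The law of one observation: the measure with density `f_ξ` with respect to `F`. -/
def obsLaw (F : Measure ℝ) (ξ : ℝ) : Measure ℝ :=
  F.withDensity fun x => ENNReal.ofReal (density F ξ x)

/-- The log-likelihood ratio `log (f_lam(x) / f_θ(x))` of one observation. -/
def logLR (F : Measure ℝ) (lam θ x : ℝ) : ℝ := Real.log (density F lam x / density F θ x)

/-- The Kullback-Leibler information number `I(lam, θ) = E_lam log (f_lam(X) / f_θ(X))`. -/
def klInfo (F : Measure ℝ) (lam θ : ℝ) : ℝ := ∫ x, logLR F lam θ x ∂(obsLaw F lam)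

/-- `P_θ`: all observations are independent with density `f_θ`. -/
def noChangeLaw (F : Measure ℝ) (θ : ℝ) : Measure SamplePath :=
  Measure.infinitePi fun _ : ℕ => obsLaw F θ

/-- The change-point law `P^{(ν)}_{θ,lam}` with `ν = m + 1`: the observations are independent,
`X_1, …, X_m` have density `f_θ` and `X_{m+1}, X_{m+2}, …` have density `f_lam`. -/
def changeLaw (F : Measure ℝ) (θ lam : ℝ) (m : ℕ) : Measure SamplePath :=
  Measure.infinitePi fun i : ℕ => if i < m then obsLaw F θ else obsLaw F lam

/-- The filtration of the observations: at time `n` it is `σ(X_1, …, X_n)`, so it is trivial at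
time `0`. -/
def obsFiltration : Filtration ℕ (MeasurableSpace.pi : MeasurableSpace SamplePath) where
  seq n := Filtration.piFinset (X := fun _ : ℕ => ℝ) (Finset.range n)
  mono' _ _ h := Filtration.piFinset.mono (Finset.range_mono h)
  le' n := Filtration.piFinset.le (Finset.range n)

/-- The long average run length `E_θ N`, with values in `[0, ∞]`. -/
def longARL (F : Measure ℝ) (θ : ℝ) (N : SamplePath → ℕ∞) : ℝ≥0∞ :=
  ∫⁻ ω, (N ω : ℝ≥0∞) ∂(noChangeLaw F θ)

/-- Lorden's worst case detection delay
`sup_{ν ≥ 1} ess sup E^{(ν)}_{θ,lam} [(N - ν + 1)^+ | X_1, …, X_{ν-1}]`, with `ν = m + 1`;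
the subtraction in `ℕ∞` is truncated at `0`. -/
def worstDelay (F : Measure ℝ) (θ lam : ℝ) (N : SamplePath → ℕ∞) : ℝ≥0∞ :=
  ⨆ m : ℕ, essSup
    (condLExp (obsFiltration m) (changeLaw F θ lam m) fun ω => ((N ω - (m : ℕ∞) : ℕ∞) : ℝ≥0∞))
    (changeLaw F θ lam m)

/-- The open-ended test of the hypotheses `θ ∈ Θ` against `lam`:
`inf {n ≥ 1 : ∑_{i=1}^n log (f_lam(X_i) / f_θ(X_i)) ≥ I(lam, θ) a for all θ ∈ Θ}`,
which is `⊤` if there is no such `n`. -/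
def openEndedTest (F : Measure ℝ) (lam : ℝ) (Θ : Set ℝ) (a : ℝ) (ω : SamplePath) : ℕ∞ :=
  ⨅ (n : ℕ) (_ : 1 ≤ n)
    (_ : ∀ θ ∈ Θ, klInfo F lam θ * a ≤ ∑ i ∈ Finset.range n, logLR F lam θ (ω i)), (n : ℕ∞)

/-- `N^* = min_{k ≥ 1} (N_k + k - 1)`, where `N_k` is `N` applied to `X_k, X_{k+1}, …`; here the
index `j` is `k - 1`. -/
def repeated (N : SamplePath → ℕ∞) (ω : SamplePath) : ℕ∞ :=
  ⨅ j : ℕ, (N (fun i => ω (i + j)) + (j : ℕ∞))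

/-- The detection procedure obtained by repeating the open-ended test. -/
def detection (F : Measure ℝ) (lam : ℝ) (Θ : Set ℝ) (a : ℝ) : SamplePath → ℕ∞ :=
  repeated (openEndedTest F lam Θ a)

/-- The half-open parameter set `(lo, θ₁]`, where `lo` may be `-∞`. -/
def halfOpen (lo : EReal) (θ₁ : ℝ) : Set ℝ := {θ : ℝ | lo < (θ : EReal) ∧ θ ≤ θ₁}

/-- The constant `((lam - θ₁) / I(lam, θ₁)) √(b''(lam) / (2π))`. -/
def delayConst (F : Measure ℝ) (lam θ₁ : ℝ) : ℝ :=
  (lam - θ₁) / klInfo F lam θ₁ * √(iteratedDeriv 2 (logNorm F) lam / (2 * Real.pi))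

end ExpFamilyChange

end

open ExpFamilyChange

namespace ExpFamilyChange

/-! Lower bound for the run length. The Shiryaev–Roberts statistic `R_n`, the sum over all starting
points of the likelihood ratios of `lam` against `θ` up to time `n`, makes `R_n - n` a martingale
under `P_θ`. When the detection rule stops, one summand is at least `exp(I(lam,θ)a)`, so optional
stopping gives the bound for its mean (`srStat_stopping_le`, `exp_le_longARL_detection`).

Upper bound for the delay. The test restarted at the change point is independent of the past, so the
worst delay is at most the mean under `lam` of one open-ended test (`worstDelay_detection_le`). By
convexity of `b`, from time `a` on the criterion for `θ₁` implies all the others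
(`test_all_of_test`). Hence the test ends at the latest when, after time `a`, the `θ₁`
log-likelihood walk crosses `I(lam,θ₁)a`. By the central limit theorem the walk lacks at time `a` on
average about `(lam-θ₁)√(a b''(lam)/(2π))`, and by Wald's identity making this up takes the deficit
divided by the drift `I(lam,θ₁)`. This is the term `Ĉ√a`.

Optimality. If `E_θ N > g`, then from some time `m` on, given `N > m`, a false alarm within `t`
steps has `P_θ`-probability at most `t/g` (`exists_conditional_alarm_le`). A delay bound `B` forces
an alarm within `t` steps of a change at `m` with conditional probability at least `1 - B/t`.
Separating the two laws this well needs information about `log(g/t)`, while on average at most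
`I(lam,θ)B` is collected before stopping (`information_le`). With `t` about `B²` this gives `log g ≤
I(lam,θ)B + O(log B)`, and the logarithm is negligible against `√a`. -/

theorem measurable_obs {i n : ℕ} (h : i < n) :
    Measurable[obsFiltration n] (fun ω : SamplePath => ω i) := by
  have h1 : Measurable[obsFiltration n] ((Finset.range n).restrict (π := fun _ : ℕ => ℝ)) :=
    comap_measurable _
  exact (measurable_pi_apply (⟨i, Finset.mem_range.2 h⟩ : Finset.range n)).comp h1

/-- The σ-algebra generated by the observations from index `n` on. -/
abbrev futureSigma (n : ℕ) : MeasurableSpace SamplePath :=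
  ⨆ i ∈ Set.Ici n, MeasurableSpace.comap (fun ω : SamplePath => ω i) inferInstance

theorem futureSigma_le (n : ℕ) : futureSigma n ≤ MeasurableSpace.pi :=
  iSup₂_le fun i _ => (measurable_pi_apply i).comap_le

theorem measurable_obs_future {i n : ℕ} (h : n ≤ i) :
    Measurable[futureSigma n] (fun ω : SamplePath => ω i) := by
  refine measurable_iff_comap_le.2 ?_
  exact le_iSup₂ (f := fun i (_ : i ∈ Set.Ici n) =>
    MeasurableSpace.comap (fun ω : SamplePath => ω i) inferInstance) i h

theorem obsFiltration_le_iSup (n : ℕ) : obsFiltration n ≤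
    ⨆ i ∈ Set.Iio n, MeasurableSpace.comap (fun ω : SamplePath => ω i) inferInstance := by
  refine measurable_iff_comap_le.1 ?_
  refine @measurable_pi_lambda _ _ _ (_) _ _ fun i => ?_
  refine measurable_iff_comap_le.2 ?_
  exact le_iSup₂ (f := fun i (_ : i ∈ Set.Iio n) =>
    MeasurableSpace.comap (fun ω : SamplePath => ω i) inferInstance) i.1
      (Finset.mem_range.1 i.2)

/-! ### Product laws: independence, change of measure, shift. -/

section Product

variable (μ : ℕ → Measure ℝ) [∀ i, IsProbabilityMeasure (μ i)]

/-- Under a product law, past and future observations are independent. -/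
theorem indep_past_future (n : ℕ) :
    Indep (obsFiltration n) (futureSigma n) (Measure.infinitePi μ) := by
  have h : iIndepFun (fun i (ω : SamplePath) => ω i) (Measure.infinitePi μ) :=
    iIndepFun_infinitePi (P := μ) (X := fun _ x => x) fun _ => measurable_id
  have := indep_iSup_of_disjoint (fun i => (measurable_pi_apply i).comap_le) h
    (S := Set.Iio n) (T := Set.Ici n)
    (Set.disjoint_left.2 fun a h1 h2 => absurd (Set.mem_Iio.1 h1) (not_lt.2 (Set.mem_Ici.1 h2)))
  exact indep_of_indep_of_le_left this (obsFiltration_le_iSup n)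

theorem lintegral_mul_future {n : ℕ} {f g : SamplePath → ℝ≥0∞}
    (hf : Measurable[obsFiltration n] f) (hg : Measurable[futureSigma n] g) :
    ∫⁻ ω, f ω * g ω ∂Measure.infinitePi μ =
      (∫⁻ ω, f ω ∂Measure.infinitePi μ) * ∫⁻ ω, g ω ∂Measure.infinitePi μ :=
  lintegral_mul_eq_lintegral_mul_lintegral_of_independent_measurableSpace
    (obsFiltration.le n) (futureSigma_le n) (indep_past_future μ n) hf hg

theorem lintegral_infinitePi_eval (n : ℕ) {g : ℝ → ℝ≥0∞} (hg : Measurable g) :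
    ∫⁻ ω, g (ω n) ∂Measure.infinitePi μ = ∫⁻ x, g x ∂μ n := by
  rw [← Measure.infinitePi_map_eval μ n, lintegral_map hg (measurable_pi_apply n)]

theorem integral_infinitePi_eval (n : ℕ) {g : ℝ → ℝ} (hg : Measurable g) :
    ∫ ω, g (ω n) ∂Measure.infinitePi μ = ∫ x, g x ∂μ n := by
  rw [← Measure.infinitePi_map_eval μ n,
    integral_map (measurable_pi_apply n).aemeasurable hg.aestronglyMeasurable]

theorem integrable_infinitePi_eval (n : ℕ) {g : ℝ → ℝ} (hg : Integrable g (μ n)) :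
    Integrable (fun ω : SamplePath => g (ω n)) (Measure.infinitePi μ) := by
  have := Measure.infinitePi_map_eval μ n
  rw [← this] at hg
  exact hg.comp_measurable (measurable_pi_apply n)

theorem lintegral_mul_obs {n : ℕ} {f : SamplePath → ℝ≥0∞} {g : ℝ → ℝ≥0∞}
    (hf : Measurable[obsFiltration n] f) (hg : Measurable g) :
    ∫⁻ ω, f ω * g (ω n) ∂Measure.infinitePi μ =
      (∫⁻ ω, f ω ∂Measure.infinitePi μ) * ∫⁻ x, g x ∂μ n := by
  rw [lintegral_mul_future μ hf (g := fun ω => g (ω n)) (hg.comp (measurable_obs_future le_rfl)),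
    lintegral_infinitePi_eval μ n hg]

/-- Wald's identity for one step: the event is determined by the past. -/
theorem integral_indicator_obs {n : ℕ} {s : Set SamplePath} {g : ℝ → ℝ}
    (hs : MeasurableSet[obsFiltration n] s) (hg : Measurable g) :
    ∫ ω, s.indicator (fun ω => g (ω n)) ω ∂Measure.infinitePi μ =
      (Measure.infinitePi μ).real s * ∫ x, g x ∂μ n := by
  have hs' := obsFiltration.le n s hs
  have hi : IndepFun (s.indicator fun _ => (1 : ℝ)) (fun ω : SamplePath => g (ω n))
      (Measure.infinitePi μ) := by
    refine indep_of_indep_of_le_right (indep_of_indep_of_le_left (indep_past_future μ n) ?_) ?_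
    · exact measurable_iff_comap_le.1 (@Measurable.indicator _ _ (_) _ _ _ _ measurable_const hs)
    · exact measurable_iff_comap_le.1 (hg.comp (measurable_obs_future le_rfl))
  have h := hi.integral_fun_mul_eq_mul_integral
    ((measurable_const.indicator hs').aestronglyMeasurable)
    ((hg.comp (measurable_pi_apply n)).aestronglyMeasurable)
  rw [integral_infinitePi_eval μ n hg, integral_indicator_const _ hs', smul_eq_mul, mul_one] at h
  rw [← h]
  congr 1 with ω
  by_cases hω : ω ∈ s <;> simp [hω]

/-- Product laws with the same first `n` factors agree on the first `n` observations. -/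
theorem infinitePi_congr_past (ν : ℕ → Measure ℝ) [∀ i, IsProbabilityMeasure (ν i)] {n : ℕ}
    (h : ∀ i < n, μ i = ν i) {s : Set SamplePath} (hs : MeasurableSet[obsFiltration n] s) :
    Measure.infinitePi μ s = Measure.infinitePi ν s := by
  obtain ⟨t, ht, rfl⟩ := hs
  rw [← Measure.map_apply (Finset.measurable_restrict _) ht,
    ← Measure.map_apply (Finset.measurable_restrict _) ht,
    Measure.infinitePi_map_restrict, Measure.infinitePi_map_restrict]
  congr 2
  funext i
  exact h _ (Finset.mem_range.1 i.2)

/-- Change of finitely many factors of a product law. -/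
theorem infinitePi_withDensity (ν : ℕ → Measure ℝ) [∀ i, IsProbabilityMeasure (ν i)]
    (S : Finset ℕ) (h : ℕ → ℝ → ℝ≥0∞) (hh : ∀ i, Measurable (h i))
    (hin : ∀ i ∈ S, ν i = (μ i).withDensity (h i)) (hout : ∀ i ∉ S, ν i = μ i) :
    Measure.infinitePi ν =
      (Measure.infinitePi μ).withDensity fun ω => ∏ i ∈ S, h i (ω i) := by
  symm
  refine Measure.eq_infinitePi ν fun s t ht => ?_
  have hst : MeasurableSet (Set.pi (s : Set ℕ) t) :=
    MeasurableSet.pi s.countable_toSet fun i _ => ht i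
  rw [withDensity_apply _ hst, ← lintegral_indicator hst]
  -- The indicator of a box and the density are both products over coordinates. Padding each with
  -- factors `1` lets both run over `s ∪ S`, so independence splits the integral.
  have hiI : iIndepFun (fun i (ω : SamplePath) =>
      (if i ∈ s then (t i).indicator 1 (ω i) else 1) * (if i ∈ S then h i (ω i) else 1))
      (Measure.infinitePi μ) := by
    refine iIndepFun_infinitePi (P := μ) (X := fun i x =>
      (if i ∈ s then (t i).indicator (1 : ℝ → ℝ≥0∞) x else 1) * (if i ∈ S then h i x else 1))
      fun i => ?_
    split_ifs <;> first | exact (measurable_one.indicator (ht i)).mul (hh i) | skip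
    all_goals simp only [one_mul, mul_one]
    all_goals first | exact measurable_one.indicator (ht i) | exact hh i | exact measurable_const
  have hm : ∀ i, Measurable fun x : ℝ =>
      (if i ∈ s then (t i).indicator (1 : ℝ → ℝ≥0∞) x else 1) * (if i ∈ S then h i x else 1) := by
    intro i
    split_ifs <;> first | exact (measurable_one.indicator (ht i)).mul (hh i) | skip
    all_goals simp only [one_mul, mul_one]
    all_goals first | exact measurable_one.indicator (ht i) | exact hh i | exact measurable_const
  have key := lintegral_prod_eq_prod_lintegral_of_indepFun (s ∪ S) _ hiI
    fun i => (hm i).comp (measurable_pi_apply i)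
  have e1 : ∀ ω : SamplePath, (Set.pi (s : Set ℕ) t).indicator
      (fun ω => ∏ i ∈ S, h i (ω i)) ω = ∏ i ∈ s ∪ S,
      ((if i ∈ s then (t i).indicator 1 (ω i) else 1) * (if i ∈ S then h i (ω i) else 1)) := by
    intro ω
    rw [Finset.prod_mul_distrib, Finset.prod_ite_mem, Finset.prod_ite_mem,
      Finset.union_inter_cancel_left, Finset.union_inter_cancel_right]
    by_cases hω : ω ∈ Set.pi (s : Set ℕ) t
    · have h1 : ∏ i ∈ s, (t i).indicator (1 : ℝ → ℝ≥0∞) (ω i) = 1 :=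
        Finset.prod_eq_one fun i hi => Set.indicator_of_mem (hω i hi) _
      rw [Set.indicator_of_mem hω, h1, one_mul]
    · rw [Set.indicator_of_notMem hω]
      simp only [Set.mem_pi, not_forall] at hω
      obtain ⟨i, hi, hit⟩ := hω
      rw [Finset.prod_eq_zero hi (Set.indicator_of_notMem hit _), zero_mul]
  rw [lintegral_congr e1, key]
  have e2 : ∀ i ∈ s ∪ S, ∫⁻ ω : SamplePath, (if i ∈ s then (t i).indicator 1 (ω i) else 1) *
      (if i ∈ S then h i (ω i) else 1) ∂Measure.infinitePi μ = if i ∈ s then ν i (t i) else 1 := by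
    intro i _
    rw [lintegral_infinitePi_eval μ i (hm i)]
    have : ∫⁻ x, (if i ∈ s then (t i).indicator (1 : ℝ → ℝ≥0∞) x else 1) *
        (if i ∈ S then h i x else 1) ∂μ i =
        ∫⁻ x, (if i ∈ s then (t i).indicator (1 : ℝ → ℝ≥0∞) x else 1) ∂ν i := by
      by_cases hS : i ∈ S
      · rw [hin i hS, lintegral_withDensity_eq_lintegral_mul _ (hh i)]
        · simp [hS, mul_comm]
        · split_ifs
          exacts [measurable_one.indicator (ht i), measurable_const]
      · simp [hS, hout i hS]
    rw [this]
    split_ifs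
    · rw [lintegral_indicator_one (ht i)]
    · simp
  rw [Finset.prod_congr rfl e2, Finset.prod_ite_mem, Finset.union_inter_cancel_left]

/-- The shifted path of observations has the product law of the shifted factors. -/
theorem infinitePi_map_shift (m : ℕ) :
    (Measure.infinitePi μ).map (fun (ω : SamplePath) i => ω (i + m)) =
      Measure.infinitePi fun i => μ (i + m) :=
  Measure.map_infinitePi_infinitePi_of_inj (f := fun i => i + m) (add_left_injective m)

theorem setLIntegral_shift {m : ℕ} {s : Set SamplePath} (hs : MeasurableSet[obsFiltration m] s)
    {g : SamplePath → ℝ≥0∞} (hg : Measurable g) :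
    ∫⁻ ω in s, g (fun i => ω (i + m)) ∂Measure.infinitePi μ =
      Measure.infinitePi μ s * ∫⁻ ω, g ω ∂(Measure.infinitePi fun i => μ (i + m)) := by
  have hs' := obsFiltration.le m s hs
  have hsh : Measurable fun (ω : SamplePath) (i : ℕ) => ω (i + m) :=
    measurable_pi_lambda _ fun i => measurable_pi_apply _
  have hf : Measurable[futureSigma m] fun ω : SamplePath => g fun i => ω (i + m) :=
    hg.comp (@measurable_pi_lambda _ _ _ (_) _ _
      fun i => measurable_obs_future (Nat.le_add_left m i))
  have h := lintegral_mul_future μ  (f := s.indicator fun _ => 1)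
    (@Measurable.indicator _ _ (_) _ _ _ _ measurable_const hs) hf
  rw [lintegral_indicator_const hs', one_mul, ← lintegral_map hg hsh, infinitePi_map_shift] at h
  rw [← h, ← lintegral_indicator hs']
  refine lintegral_congr fun ω => ?_
  by_cases hω : ω ∈ s <;> simp [hω]

end Product

/-! ### The exponential family: tilting, information numbers, convexity. -/

section Family

variable {F : Measure ℝ}

theorem logNorm_eq_cgf (F : Measure ℝ) : logNorm F = cgf id F := rfl

theorem measurable_density (F : Measure ℝ) (ξ : ℝ) : Measurable (density F ξ) := by
  unfold density; fun_prop

theorem density_pos (F : Measure ℝ) (ξ x : ℝ) : 0 < density F ξ x := Real.exp_pos _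

theorem logLR_eq (F : Measure ℝ) (lam θ x : ℝ) :
    logLR F lam θ x = (lam - θ) * x - (logNorm F lam - logNorm F θ) := by
  rw [logLR, density, density, ← Real.exp_sub, Real.log_exp]; ring

theorem measurable_logLR (F : Measure ℝ) (lam θ : ℝ) : Measurable (logLR F lam θ) := by
  simp only [funext (logLR_eq F lam θ)]; fun_prop

theorem sum_logLR (F : Measure ℝ) (lam θ : ℝ) (n : ℕ) (x : ℕ → ℝ) :
    ∑ i ∈ Finset.range n, logLR F lam θ (x i) =
      (lam - θ) * ∑ i ∈ Finset.range n, x i - n * (logNorm F lam - logNorm F θ) := by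
  simp only [logLR_eq, Finset.sum_sub_distrib, Finset.mul_sum, Finset.sum_const,
    Finset.card_range, nsmul_eq_mul]
  ring

theorem logLR_neg (F : Measure ℝ) (lam θ x : ℝ) : logLR F lam θ x = -logLR F θ lam x := by
  rw [logLR_eq, logLR_eq]; ring

theorem obsLaw_withDensity (F : Measure ℝ) (lam θ : ℝ) :
    obsLaw F lam =
      (obsLaw F θ).withDensity fun x => ENNReal.ofReal (Real.exp (logLR F lam θ x)) := by
  have h1 := (measurable_density F θ).ennreal_ofReal
  have h2 := (measurable_logLR F lam θ).exp.ennreal_ofReal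
  rw [obsLaw, obsLaw, ← withDensity_mul _ h1 h2]
  congr 1 with x
  rw [Pi.mul_apply, ← ENNReal.ofReal_mul (density_pos F θ x).le, density, density, logLR_eq,
    ← Real.exp_add]
  congr 2; ring

theorem integrable_exp_of_mem_interior {ξ : ℝ} (hξ : ξ ∈ interior (integrableExpSet id F)) :
    Integrable (fun x => Real.exp (ξ * x)) F :=
  interior_subset (s := integrableExpSet id F) hξ

/-- Viewing the law as an exponential tilt of `F` gives its normalization and, at interior
parameters, all its moments and the identity of `b''` with the variance. -/
theorem obsLaw_eq_tilted {ξ : ℝ} (hξ : Integrable (fun x => Real.exp (ξ * x)) F) :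
    obsLaw F ξ = F.tilted fun x => ξ * id x := by
  ext s hs
  rw [tilted_mul_apply_cgf' (X := id) hs hξ, obsLaw, withDensity_apply _ hs]
  rfl

theorem isProbabilityMeasure_obsLaw [NeZero F] {ξ : ℝ}
    (hξ : Integrable (fun x => Real.exp (ξ * x)) F) : IsProbabilityMeasure (obsLaw F ξ) := by
  rw [obsLaw_eq_tilted hξ]; exact isProbabilityMeasure_tilted hξ

theorem absolutelyContinuous_obsLaw {ξ : ℝ}
    (hξ : Integrable (fun x => Real.exp (ξ * x)) F) : F ≪ obsLaw F ξ := by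
  rw [obsLaw_eq_tilted hξ]; exact absolutelyContinuous_tilted hξ

theorem memLp_obsLaw {ξ : ℝ} (hξ : ξ ∈ interior (integrableExpSet id F)) (p : NNReal) :
    MemLp (fun x : ℝ => x) p (obsLaw F ξ) := by
  rw [obsLaw_eq_tilted (integrable_exp_of_mem_interior hξ)]; exact memLp_tilted_mul hξ p

theorem integrable_obsLaw {ξ : ℝ} (hξ : ξ ∈ interior (integrableExpSet id F)) :
    Integrable (fun x : ℝ => x) (obsLaw F ξ) :=
  memLp_one_iff_integrable.1 (by simpa using memLp_obsLaw hξ 1)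

theorem variance_obsLaw {ξ : ℝ} (hξ : ξ ∈ interior (integrableExpSet id F)) :
    Var[fun x : ℝ => x; obsLaw F ξ] = iteratedDeriv 2 (logNorm F) ξ := by
  rw [obsLaw_eq_tilted (integrable_exp_of_mem_interior hξ), logNorm_eq_cgf]
  exact variance_tilted_mul hξ

variable [NeZero F]

theorem integrable_logLR {lam : ℝ} (hlam : lam ∈ interior (integrableExpSet id F)) (θ : ℝ) :
    Integrable (logLR F lam θ) (obsLaw F lam) := by
  have := isProbabilityMeasure_obsLaw (F := F) (integrable_exp_of_mem_interior hlam)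
  simp only [funext (logLR_eq F lam θ)]
  exact ((integrable_obsLaw hlam).const_mul _).sub (integrable_const _)

theorem klInfo_eq {lam : ℝ} (hlam : lam ∈ interior (integrableExpSet id F)) (θ : ℝ) :
    klInfo F lam θ =
      (lam - θ) * (∫ x, x ∂obsLaw F lam) - (logNorm F lam - logNorm F θ) := by
  have := isProbabilityMeasure_obsLaw (F := F) (integrable_exp_of_mem_interior hlam)
  simp only [klInfo, logLR_eq]
  rw [integral_sub ((integrable_obsLaw hlam).const_mul _) (integrable_const _),
    integral_const_mul]
  simp

theorem lintegral_exp_logLR (lam : ℝ) {θ : ℝ}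
    (hlam : Integrable (fun x => Real.exp (lam * x)) F) :
    ∫⁻ x, ENNReal.ofReal (Real.exp (logLR F lam θ x)) ∂obsLaw F θ = 1 := by
  have := isProbabilityMeasure_obsLaw hlam
  rw [← measure_univ (μ := obsLaw F lam), obsLaw_withDensity F lam θ,
    withDensity_apply _ MeasurableSet.univ, setLIntegral_univ]

theorem integral_exp_logLR (lam : ℝ) {θ : ℝ}
    (hlam : Integrable (fun x => Real.exp (lam * x)) F) :
    Integrable (fun x => Real.exp (logLR F lam θ x)) (obsLaw F θ) ∧
    ∫ x, Real.exp (logLR F lam θ x) ∂obsLaw F θ = 1 := by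
  have h := lintegral_exp_logLR (θ := θ) lam hlam
  have hm := (measurable_logLR F lam θ).exp
  refine ⟨⟨hm.aestronglyMeasurable, ?_⟩, ?_⟩
  · rw [hasFiniteIntegral_iff_ofReal (ae_of_all _ fun x => (Real.exp_pos _).le), h]
    exact ENNReal.one_lt_top
  · rw [integral_eq_lintegral_of_nonneg_ae (ae_of_all _ fun x => (Real.exp_pos _).le)
      hm.aestronglyMeasurable, h, ENNReal.toReal_one]

/-- The likelihood ratio `exp(-L)` has mean one under `lam`, so adding `exp(-L) - 1` leaves the
integral of `L` unchanged but makes the integrand nonnegative, with zeros only at `L = 0`. Sign and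
positivity of the information follow. -/
theorem integral_kl_integrand {lam θ : ℝ} (hlam : lam ∈ interior (integrableExpSet id F))
    (hθ : Integrable (fun x => Real.exp (θ * x)) F) :
    Integrable (fun x => Real.exp (-logLR F lam θ x) - 1 + logLR F lam θ x) (obsLaw F lam) ∧
    ∫ x, (Real.exp (-logLR F lam θ x) - 1 + logLR F lam θ x) ∂obsLaw F lam =
      klInfo F lam θ := by
  have := isProbabilityMeasure_obsLaw (F := F) (integrable_exp_of_mem_interior hlam)
  obtain ⟨h1, h2⟩ := integral_exp_logLR (θ := lam) θ hθ
  simp only [logLR_neg F θ lam] at h1 h2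
  have h3 := integrable_logLR hlam θ
  have h4 : Integrable (fun x => Real.exp (-logLR F lam θ x) - 1) (obsLaw F lam) :=
    h1.sub (integrable_const (1 : ℝ))
  refine ⟨h4.add h3, ?_⟩
  rw [integral_add h4 h3, integral_sub h1 (integrable_const _), h2, klInfo]
  simp

theorem klInfo_nonneg {lam θ : ℝ} (hlam : lam ∈ interior (integrableExpSet id F))
    (hθ : Integrable (fun x => Real.exp (θ * x)) F) : 0 ≤ klInfo F lam θ := by
  rw [← (integral_kl_integrand hlam hθ).2]
  exact integral_nonneg fun x => by
    have := Real.add_one_le_exp (-logLR F lam θ x)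
    show 0 ≤ Real.exp (-logLR F lam θ x) - 1 + logLR F lam θ x
    linarith

theorem klInfo_pos {lam θ : ℝ} (hlam : lam ∈ interior (integrableExpSet id F))
    (hθ : Integrable (fun x => Real.exp (θ * x)) F) (hne : θ < lam)
    (hnd : ∀ c : ℝ, ¬ ∀ᵐ x ∂F, x = c) : 0 < klInfo F lam θ := by
  refine lt_of_le_of_ne (klInfo_nonneg hlam hθ) fun h0 => ?_
  obtain ⟨h1, h2⟩ := integral_kl_integrand hlam hθ
  rw [← h0, integral_eq_zero_iff_of_nonneg _ h1] at h2
  -- The only zero of the affine function `logLR F lam θ`.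
  · refine hnd ((logNorm F lam - logNorm F θ) / (lam - θ)) ?_
    filter_upwards [(absolutelyContinuous_obsLaw (integrable_exp_of_mem_interior hlam)).ae_le h2] with x hx
    have hL : logLR F lam θ x = 0 := by
      by_contra hne
      have := Real.add_one_lt_exp (neg_ne_zero.2 hne)
      simp only [Pi.zero_apply] at hx
      linarith
    rw [logLR_eq] at hL
    rw [eq_div_iff (by linarith)]
    linarith
  · intro x
    have := Real.add_one_le_exp (-logLR F lam θ x)
    show 0 ≤ Real.exp (-logLR F lam θ x) - 1 + logLR F lam θ x
    linarith

theorem variance_pos {lam : ℝ} (hlam : lam ∈ interior (integrableExpSet id F))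
    (hnd : ∀ c : ℝ, ¬ ∀ᵐ x ∂F, x = c) : 0 < iteratedDeriv 2 (logNorm F) lam := by
  have := isProbabilityMeasure_obsLaw (F := F) (integrable_exp_of_mem_interior hlam)
  rw [← variance_obsLaw hlam]
  refine lt_of_le_of_ne (variance_nonneg _ _) fun h0 => hnd (∫ x, x ∂obsLaw F lam) ?_
  exact (absolutelyContinuous_obsLaw (integrable_exp_of_mem_interior hlam)).ae_le
    (ae_eq_integral_of_variance_eq_zero (by simpa using memLp_obsLaw hlam 2) h0.symm)

/-- The secant slopes of the log-normalizer to a fixed right end point increase. -/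
theorem logNorm_slope_le {θ θ₁ lam : ℝ} (hθ : Integrable (fun x => Real.exp (θ * x)) F)
    (hθ₁ : θ₁ ∈ interior (integrableExpSet id F))
    (hlam : Integrable (fun x => Real.exp (lam * x)) F) (h1 : θ ≤ θ₁) (h2 : θ₁ < lam) :
    (logNorm F lam - logNorm F θ) * (lam - θ₁) ≤
      (logNorm F lam - logNorm F θ₁) * (lam - θ) := by
  -- Convexity of `b`: nonnegativity of these two information numbers says that the tangent at `θ₁`
  -- lies below `b` at `θ` and at `lam`.
  have k1 := klInfo_nonneg hθ₁ hθ
  have k2 := klInfo_nonneg hθ₁ hlam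
  rw [klInfo_eq hθ₁] at k1 k2
  nlinarith [mul_nonneg k1 (sub_nonneg.2 h2.le), mul_nonneg k2 (sub_nonneg.2 h1)]

end Family

/-! ### Nondegeneracy of `F`, deduced from the limit of the means. -/

theorem mem_interior_integrableExpSet {F : Measure ℝ} {lo hi : EReal}
    (hΩ : ∀ ξ : ℝ, Integrable (fun x : ℝ => Real.exp (ξ * x)) F ↔
      lo < (ξ : EReal) ∧ (ξ : EReal) < hi) {ξ : ℝ} (h : lo < (ξ : EReal))
    (h' : (ξ : EReal) < hi) : ξ ∈ interior (integrableExpSet id F) := by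
  have : integrableExpSet id F = Real.toEReal ⁻¹' Set.Ioo lo hi := by
    ext ξ; exact hΩ ξ
  rw [this, (isOpen_Ioo.preimage continuous_coe_real_ereal).interior_eq]
  exact ⟨h, h'⟩

/-- The means tend to `-∞`, so they are not all equal. -/
theorem not_forall_mean_eq {F : Measure ℝ} {lo : EReal}
    (hmean : Tendsto (fun θ : ℝ => ∫ x, x ∂(obsLaw F θ))
      (comap Real.toEReal (𝓝[>] lo)) atBot) {θ₁ : ℝ} (hlo : lo < (θ₁ : EReal)) (c : ℝ) :
    ¬ ∀ θ : ℝ, lo < (θ : EReal) → θ ≤ θ₁ → ∫ x, x ∂(obsLaw F θ) = c := by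
  intro h
  have h1 : ∀ᶠ y in 𝓝[>] lo, y ∈ Set.Ioo lo (θ₁ : EReal) := Ioo_mem_nhdsGT hlo
  have h2 := (preimage_mem_comap (m := Real.toEReal) h1)
  -- Real numbers accumulate at `lo` from the right, also for `lo = -∞`; along the trivial filter
  -- the limit would carry no information.
  have : (comap Real.toEReal (𝓝[>] lo)).NeBot := by
    refine comap_neBot fun s hs => ?_
    obtain ⟨u, hu, hus⟩ := (mem_nhdsGT_iff_exists_Ioo_subset' hlo).1 hs
    obtain ⟨x, hx1, hx2⟩ := EReal.lt_iff_exists_real_btwn.1 (Set.mem_Ioi.1 hu)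
    exact ⟨x, hus ⟨hx1, hx2⟩⟩
  obtain ⟨θ, hθ1, hθ2⟩ := ((hmean.eventually (eventually_le_atBot (c - 1))).and h2).exists
  have := h θ hθ2.1 (EReal.coe_le_coe_iff.1 hθ2.2.le)
  linarith

theorem neZero_of_mean {F : Measure ℝ} {lo : EReal}
    (hmean : Tendsto (fun θ : ℝ => ∫ x, x ∂(obsLaw F θ))
      (comap Real.toEReal (𝓝[>] lo)) atBot) {θ₁ : ℝ} (hlo : lo < (θ₁ : EReal)) : NeZero F := by
  refine ⟨fun h0 => not_forall_mean_eq hmean hlo 0 fun θ _ _ => ?_⟩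
  simp [obsLaw, h0]

theorem not_ae_eq_const {F : Measure ℝ} {lo hi : EReal}
    (hΩ : ∀ ξ : ℝ, Integrable (fun x : ℝ => Real.exp (ξ * x)) F ↔
      lo < (ξ : EReal) ∧ (ξ : EReal) < hi)
    (hmean : Tendsto (fun θ : ℝ => ∫ x, x ∂(obsLaw F θ))
      (comap Real.toEReal (𝓝[>] lo)) atBot) {θ₁ : ℝ} (hlo : lo < (θ₁ : EReal))
    (hhi : (θ₁ : EReal) < hi) (c : ℝ) : ¬ ∀ᵐ x ∂F, x = c := by
  intro hc
  have := neZero_of_mean hmean hlo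
  refine not_forall_mean_eq hmean hlo c fun θ h1 h2 => ?_
  have := isProbabilityMeasure_obsLaw
    ((hΩ θ).2 ⟨h1, (EReal.coe_le_coe_iff.2 h2).trans_lt hhi⟩)
  have hac : obsLaw F θ ≪ F := withDensity_absolutelyContinuous _ _
  rw [integral_congr_ae (hac.ae_le hc)]
  simp

theorem enat_toENNReal_eq_tsum (N : ℕ∞) :
    (N : ℝ≥0∞) = ∑' k : ℕ, if (k : ℕ∞) < N then 1 else 0 := by
  induction N using ENat.recTopCoe with
  | top => simp
  | coe n =>
    rw [tsum_eq_sum (s := Finset.range n) fun b hb => if_neg (by simpa using hb)]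
    rw [Finset.sum_congr rfl fun k hk => if_pos (by simpa using hk)]
    simp

theorem sum_lt_le_sub (N : ℕ∞) (m t : ℕ) :
    ∑ k ∈ Finset.Ico m (m + t), (if (k : ℕ∞) < N then (1 : ℝ≥0∞) else 0) ≤
      ((N - m : ℕ∞) : ℝ≥0∞) := by
  rw [enat_toENNReal_eq_tsum, Finset.sum_Ico_eq_sum_range]
  refine le_trans (le_of_eq ?_) (ENNReal.sum_le_tsum (Finset.range (m + t - m)))
  refine Finset.sum_congr rfl fun k _ => ?_
  have : ((m + k : ℕ) : ℕ∞) < N ↔ (k : ℕ∞) < N - m := by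
    rw [lt_tsub_iff_left]; push_cast; rfl
  simp only [this]

/-! ### Stopping times and the Shiryaev–Roberts martingale. -/

section Stopping

variable {N : SamplePath → ℕ∞}

theorem measurableSet_lt_stopping (hN : IsStoppingTime obsFiltration N) (n : ℕ) :
    MeasurableSet[obsFiltration n] {ω | (n : ℕ∞) < N ω} := by
  have := (hN n).compl
  have e : {ω | (n : ℕ∞) < N ω} = {ω | N ω ≤ (n : ℕ∞)}ᶜ := by ext ω; simp
  rw [e]; exact this

theorem measurableSet_eq_stopping (hN : IsStoppingTime obsFiltration N) (n : ℕ) :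
    MeasurableSet[obsFiltration n] {ω | N ω = (n : ℕ∞)} := hN.measurableSet_eq n

theorem lintegral_stopping (hN : IsStoppingTime obsFiltration N) (P : Measure SamplePath) :
    ∫⁻ ω, (N ω : ℝ≥0∞) ∂P = ∑' k : ℕ, P {ω | (k : ℕ∞) < N ω} := by
  have hm : ∀ k : ℕ, MeasurableSet {ω | (k : ℕ∞) < N ω} := fun k =>
    obsFiltration.le k _ (measurableSet_lt_stopping hN k)
  simp only [enat_toENNReal_eq_tsum]
  rw [lintegral_tsum fun k =>
    (Measurable.ite (hm k) measurable_const measurable_const).aemeasurable]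
  refine tsum_congr fun k => ?_
  rw [← lintegral_indicator_one (hm k)]
  refine lintegral_congr fun ω => ?_
  by_cases h : (k : ℕ∞) < N ω <;> simp [h]

/-- The Shiryaev–Roberts statistic with one-step likelihood ratio `l`. -/
noncomputable def srStat (l : ℝ → ℝ≥0∞) : ℕ → SamplePath → ℝ≥0∞
  | 0, _ => 0
  | n + 1, ω => (1 + srStat l n ω) * l (ω n)

theorem measurable_srStat {l : ℝ → ℝ≥0∞} (hl : Measurable l) (n : ℕ) :
    Measurable[obsFiltration n] (srStat l n) := by
  induction n with
  | zero => exact measurable_const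
  | succ n ih =>
    have h1 : Measurable[obsFiltration (n + 1)] (srStat l n) :=
      ih.mono (obsFiltration.mono n.le_succ) le_rfl
    exact (measurable_const.add h1).mul (hl.comp (measurable_obs n.lt_succ_self))

/-- Unrolled, the recursion is a sum of products over all nonempty windows ending at the current
time; the left side is one of these summands. -/
theorem prod_le_srStat (l : ℝ → ℝ≥0∞) (ω : SamplePath) (j : ℕ) {k : ℕ} (hk : 1 ≤ k) :
    ∏ i ∈ Finset.range k, l (ω (i + j)) ≤ srStat l (j + k) ω := by
  induction k, hk using Nat.le_induction with
  | base =>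
    simp only [Finset.range_one, Finset.prod_singleton, zero_add, srStat]
    exact le_mul_of_one_le_left' le_self_add
  | succ k hk ih =>
    rw [Finset.prod_range_succ, ← add_assoc, srStat, add_comm k j]
    gcongr
    exact ih.trans le_add_self

/-- Optional stopping at `N ∧ n` for the martingale `R_n - n`: the right side is `E[N ∧ n]` and the
left side is at most `E[R_{N ∧ n}]`. All terms are nonnegative, so the induction needs no
integrability. -/
theorem srStat_stopping_le (μ : ℕ → Measure ℝ) [∀ i, IsProbabilityMeasure (μ i)]
    {l : ℝ → ℝ≥0∞} (hl : Measurable l) (hl1 : ∀ i, ∫⁻ x, l x ∂μ i = 1)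
    (hN : IsStoppingTime obsFiltration N) {c : ℝ≥0∞}
    (hc : ∀ ω (n : ℕ), N ω = n → c ≤ srStat l n ω) (n : ℕ) :
    c * Measure.infinitePi μ {ω | N ω ≤ n} +
      ∫⁻ ω in {ω | (n : ℕ∞) < N ω}, srStat l n ω ∂Measure.infinitePi μ ≤
    ∑ k ∈ Finset.range n, Measure.infinitePi μ {ω | (k : ℕ∞) < N ω} := by
  set P := Measure.infinitePi μ
  have hlt : ∀ n : ℕ, MeasurableSet {ω | (n : ℕ∞) < N ω} := fun n =>
    obsFiltration.le n _ (measurableSet_lt_stopping hN n)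
  have heq : ∀ n : ℕ, MeasurableSet {ω | N ω = (n : ℕ∞)} := fun n =>
    obsFiltration.le n _ (measurableSet_eq_stopping hN n)
  induction n with
  | zero =>
    rcases eq_or_ne c 0 with h0 | h0
    · simp [h0, srStat]
    -- The statistic vanishes at time `0`, so for `c ≠ 0` the hypothesis on `N` forbids stopping
    -- there.
    · have : {ω | N ω ≤ ((0 : ℕ) : ℕ∞)} = ∅ := by
        ext ω
        simp only [Set.mem_ofPred_eq, Set.mem_empty_iff_false, iff_false]
        intro h
        have := hc ω 0 (le_antisymm h (by simp))
        simp only [srStat] at this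
        exact h0 (le_antisymm this zero_le)
      rw [this]; simp [srStat]
  | succ n ih =>
    have hstep : ∫⁻ ω in {ω | (n : ℕ∞) < N ω}, srStat l (n + 1) ω ∂P =
        P {ω | (n : ℕ∞) < N ω} + ∫⁻ ω in {ω | (n : ℕ∞) < N ω}, srStat l n ω ∂P := by
      have h1 : Measurable[obsFiltration n]
          ({ω | (n : ℕ∞) < N ω}.indicator fun ω => 1 + srStat l n ω) :=
        @Measurable.indicator _ _ (_) _ _ _ _
          (measurable_const.add (measurable_srStat hl n)) (measurableSet_lt_stopping hN n)
      have h2 := lintegral_mul_obs μ h1 hl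
      rw [hl1, mul_one, lintegral_indicator (hlt n), lintegral_add_left measurable_const,
        lintegral_const, Measure.restrict_apply_univ, one_mul] at h2
      rw [← h2, ← lintegral_indicator (hlt n)]
      refine lintegral_congr fun ω => ?_
      by_cases h : (n : ℕ∞) < N ω <;> simp [h, srStat]
    have hcast : ((n + 1 : ℕ) : ℕ∞) = (n : ℕ∞) + 1 := by push_cast; rfl
    have hsplit : {ω | (n : ℕ∞) < N ω} =
        {ω | N ω = ((n + 1 : ℕ) : ℕ∞)} ∪ {ω | ((n + 1 : ℕ) : ℕ∞) < N ω} := by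
      ext ω
      simp only [Set.mem_ofPred_eq, Set.mem_union]
      rw [eq_comm, ← le_iff_eq_or_lt, hcast, ENat.add_one_le_iff (ENat.natCast_ne_top n)]
    have hle : {ω | N ω ≤ ((n + 1 : ℕ) : ℕ∞)} =
        {ω | N ω ≤ (n : ℕ∞)} ∪ {ω | N ω = ((n + 1 : ℕ) : ℕ∞)} := by
      ext ω
      simp only [Set.mem_ofPred_eq, Set.mem_union]
      rw [le_iff_lt_or_eq, hcast, ENat.lt_add_one_iff (ENat.natCast_ne_top n)]
    have hd : Disjoint {ω | N ω = ((n + 1 : ℕ) : ℕ∞)} {ω | ((n + 1 : ℕ) : ℕ∞) < N ω} :=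
      Set.disjoint_left.2 fun ω h1 h2 => by
        simp only [Set.mem_ofPred_eq] at h1 h2; rw [h1] at h2; exact lt_irrefl _ h2
    have hatN : c * P {ω | N ω = ((n + 1 : ℕ) : ℕ∞)} ≤
        ∫⁻ ω in {ω | N ω = ((n + 1 : ℕ) : ℕ∞)}, srStat l (n + 1) ω ∂P := by
      rw [← setLIntegral_const]
      exact setLIntegral_mono' (heq _) fun ω hω => hc ω _ hω
    rw [hsplit, lintegral_union (hlt _) hd, ← hsplit] at hstep
    rw [Finset.sum_range_succ, hle]
    calc c * P ({ω | N ω ≤ (n : ℕ∞)} ∪ {ω | N ω = ((n + 1 : ℕ) : ℕ∞)}) +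
          ∫⁻ ω in {ω | ((n + 1 : ℕ) : ℕ∞) < N ω}, srStat l (n + 1) ω ∂P
        ≤ c * (P {ω | N ω ≤ (n : ℕ∞)} + P {ω | N ω = ((n + 1 : ℕ) : ℕ∞)}) +
          ∫⁻ ω in {ω | ((n + 1 : ℕ) : ℕ∞) < N ω}, srStat l (n + 1) ω ∂P := by
          gcongr; exact measure_union_le _ _
      _ ≤ c * P {ω | N ω ≤ (n : ℕ∞)} +
          (∫⁻ ω in {ω | N ω = ((n + 1 : ℕ) : ℕ∞)}, srStat l (n + 1) ω ∂P +
          ∫⁻ ω in {ω | ((n + 1 : ℕ) : ℕ∞) < N ω}, srStat l (n + 1) ω ∂P) := by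
          rw [mul_add, add_assoc]; gcongr
      _ = (c * P {ω | N ω ≤ (n : ℕ∞)} + ∫⁻ ω in {ω | (n : ℕ∞) < N ω}, srStat l n ω ∂P) +
          P {ω | (n : ℕ∞) < N ω} := by rw [hstep]; ring
      _ ≤ _ := by gcongr

/-- A stopping time at which the Shiryaev–Roberts statistic is at least `c` has mean at
least `c` under the law without a change. -/
theorem le_lintegral_of_le_srStat (μ : ℕ → Measure ℝ) [∀ i, IsProbabilityMeasure (μ i)]
    {l : ℝ → ℝ≥0∞} (hl : Measurable l) (hl1 : ∀ i, ∫⁻ x, l x ∂μ i = 1)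
    (hN : IsStoppingTime obsFiltration N) {c : ℝ≥0∞}
    (hc : ∀ ω (n : ℕ), N ω = n → c ≤ srStat l n ω) :
    c ≤ ∫⁻ ω, (N ω : ℝ≥0∞) ∂Measure.infinitePi μ := by
  set P := Measure.infinitePi μ
  have hsum := lintegral_stopping hN P
  by_cases htop : ∫⁻ ω, (N ω : ℝ≥0∞) ∂P = ⊤
  · rw [htop]; exact le_top
  have hm : ∀ n : ℕ, MeasurableSet {ω | N ω ≤ (n : ℕ∞)} := fun n => obsFiltration.le n _ (hN n)
  have hmN : Measurable fun ω => (N ω : ℝ≥0∞) := by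
    simp only [enat_toENNReal_eq_tsum]
    refine Measurable.tsum fun k => Measurable.ite ?_ measurable_const measurable_const
    exact obsFiltration.le k _ (measurableSet_lt_stopping hN k)
  have hbound : ∀ n : ℕ, c * P {ω | N ω ≤ (n : ℕ∞)} ≤ ∫⁻ ω, (N ω : ℝ≥0∞) ∂P := fun n =>
    (le_self_add.trans (srStat_stopping_le μ hl hl1 hN hc n)).trans
      (hsum ▸ ENNReal.sum_le_tsum _)
  have huniv : P (⋃ n : ℕ, {ω | N ω ≤ (n : ℕ∞)}) = 1 := by
    rw [← measure_univ (μ := P)]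
    refine measure_congr ?_
    filter_upwards [ae_lt_top hmN htop] with ω hω
    refine propext ⟨fun _ => trivial, fun _ => ?_⟩
    obtain ⟨n, hn⟩ := ENat.ne_top_iff_exists.1 (by simpa using hω.ne : N ω ≠ ⊤)
    exact Set.mem_iUnion.2 ⟨n, hn.symm.le⟩
  have hmono : Monotone fun n : ℕ => {ω | N ω ≤ (n : ℕ∞)} := fun a b hab ω hω =>
    le_trans (b := (a : ℕ∞)) hω (by exact_mod_cast hab)
  have ht := tendsto_measure_iUnion_atTop (μ := P) hmono
  rw [huniv] at ht
  have ht' := ENNReal.Tendsto.const_mul (a := c) ht (Or.inl one_ne_zero)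
  rw [mul_one] at ht'
  exact le_of_tendsto' ht' hbound

end Stopping

/-! ### The detection rule: stopping property and run length. -/

section Detection

variable (F : Measure ℝ) (lam : ℝ) (Θ : Set ℝ) (a : ℝ)

theorem openEndedTest_le_iff (ω : SamplePath) (n : ℕ) :
    openEndedTest F lam Θ a ω ≤ n ↔ ∃ k : ℕ, 1 ≤ k ∧ k ≤ n ∧
      ∀ θ ∈ Θ, klInfo F lam θ * a ≤ ∑ i ∈ Finset.range k, logLR F lam θ (ω i) := by
  -- With the strict bound `< n + 1`, `iInf_lt_iff` yields a witness without any discussion of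
  -- whether the infimum is attained.
  rw [← ENat.lt_add_one_iff (ENat.natCast_ne_top n)]
  simp only [openEndedTest, iInf_lt_iff]
  simp only [ENat.lt_add_one_iff (ENat.natCast_ne_top n), Nat.cast_le]
  constructor
  · rintro ⟨k, h1, h2, h3⟩; exact ⟨k, h1, h3, h2⟩
  · rintro ⟨k, h1, h2, h3⟩; exact ⟨k, h1, h3, h2⟩

theorem detection_le_iff (ω : SamplePath) (n : ℕ) :
    detection F lam Θ a ω ≤ n ↔ ∃ j k : ℕ, 1 ≤ k ∧ j + k ≤ n ∧
      ∀ θ ∈ Θ, klInfo F lam θ * a ≤ ∑ i ∈ Finset.range k, logLR F lam θ (ω (i + j)) := by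
  rw [← ENat.lt_add_one_iff (ENat.natCast_ne_top n)]
  simp only [detection, repeated, iInf_lt_iff]
  simp only [ENat.lt_add_one_iff (ENat.natCast_ne_top n)]
  refine exists_congr fun j => ?_
  constructor
  · intro h
    have hj : j ≤ n := by exact_mod_cast le_add_self.trans h
    have h' : openEndedTest F lam Θ a (fun i => ω (i + j)) ≤ ((n - j : ℕ) : ℕ∞) := by
      rw [ENat.natCast_sub]
      exact ENat.le_sub_of_add_le_right (ENat.natCast_ne_top j) h
    obtain ⟨k, h1, h2, h3⟩ := (openEndedTest_le_iff F lam Θ a _ _).1 h'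
    exact ⟨k, h1, by omega, h3⟩
  · rintro ⟨k, h1, h2, h3⟩
    have := (openEndedTest_le_iff F lam Θ a (fun i => ω (i + j)) k).2 ⟨k, h1, le_rfl, h3⟩
    calc openEndedTest F lam Θ a (fun i => ω (i + j)) + (j : ℕ∞) ≤ k + j := by gcongr
      _ ≤ n := by rw [add_comm]; exact_mod_cast h2

/-- `Θ` may be uncountable, but each condition is closed in the sum of the window, so the whole
intersection is the preimage of a closed set under one measurable function. -/
theorem measurableSet_test {m : MeasurableSpace SamplePath} (k j : ℕ)
    (hm : ∀ i < k, Measurable[m] fun ω : SamplePath => ω (i + j)) :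
    MeasurableSet[m] {ω | ∀ θ ∈ Θ, klInfo F lam θ * a ≤
      ∑ i ∈ Finset.range k, logLR F lam θ (ω (i + j))} := by
  have h1 : Measurable[m] fun ω : SamplePath => ∑ i ∈ Finset.range k, ω (i + j) :=
    Finset.measurable_sum _ fun i hi => hm i (Finset.mem_range.1 hi)
  have h2 : IsClosed {s : ℝ | ∀ θ ∈ Θ, klInfo F lam θ * a ≤
      (lam - θ) * s - k * (logNorm F lam - logNorm F θ)} := by
    simp only [Set.ofPred_forall]
    refine isClosed_iInter fun θ => isClosed_iInter fun _ => ?_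
    exact isClosed_le continuous_const (by fun_prop)
  have h3 := h1 h2.measurableSet
  refine (congrArg (MeasurableSet[m]) ?_).mp h3
  ext ω
  simp only [Set.mem_preimage, Set.mem_ofPred_eq, sum_logLR F lam _ k fun i => ω (i + j)]

theorem isStoppingTime_detection :
    IsStoppingTime obsFiltration (detection F lam Θ a) := by
  intro n
  have e : {ω | detection F lam Θ a ω ≤ (n : ℕ∞)} = ⋃ j : ℕ, ⋃ k : ℕ, ⋃ _ : 1 ≤ k,
      ⋃ _ : j + k ≤ n, {ω | ∀ θ ∈ Θ, klInfo F lam θ * a ≤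
        ∑ i ∈ Finset.range k, logLR F lam θ (ω (i + j))} := by
    ext ω
    simp only [Set.mem_ofPred_eq, detection_le_iff, Set.mem_iUnion, exists_prop]
  refine (congrArg (MeasurableSet[obsFiltration n]) e).mpr ?_
  refine MeasurableSet.iUnion fun j => MeasurableSet.iUnion fun k => MeasurableSet.iUnion fun _ =>
    MeasurableSet.iUnion fun hjk => ?_
  exact measurableSet_test F lam Θ a k j fun i hi => measurable_obs (by omega)

theorem isStoppingTime_openEndedTest :
    IsStoppingTime obsFiltration (openEndedTest F lam Θ a) := by
  intro n
  have e : {ω | openEndedTest F lam Θ a ω ≤ (n : ℕ∞)} = ⋃ k : ℕ, ⋃ _ : 1 ≤ k,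
      ⋃ _ : k ≤ n, {ω | ∀ θ ∈ Θ, klInfo F lam θ * a ≤
        ∑ i ∈ Finset.range k, logLR F lam θ (ω (i + 0))} := by
    ext ω
    simp only [Set.mem_ofPred_eq, openEndedTest_le_iff, Set.mem_iUnion, exists_prop, add_zero]
  refine (congrArg (MeasurableSet[obsFiltration n]) e).mpr ?_
  refine MeasurableSet.iUnion fun k => MeasurableSet.iUnion fun _ =>
    MeasurableSet.iUnion fun hjk => ?_
  exact measurableSet_test F lam Θ a k 0 fun i hi => measurable_obs (by omega)

theorem exp_le_longARL_detection {F : Measure ℝ} [NeZero F] {lam θ : ℝ} {Θ : Set ℝ}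
    (hlam : Integrable (fun x => Real.exp (lam * x)) F)
    (hθ : Integrable (fun x => Real.exp (θ * x)) F) (hmem : θ ∈ Θ) (a : ℝ) :
    ENNReal.ofReal (Real.exp (klInfo F lam θ * a)) ≤ longARL F θ (detection F lam Θ a) := by
  have := isProbabilityMeasure_obsLaw hθ
  refine le_lintegral_of_le_srStat (fun _ => obsLaw F θ)
    (measurable_logLR F lam θ).exp.ennreal_ofReal (fun _ => lintegral_exp_logLR lam hlam)
    (isStoppingTime_detection F lam Θ a) fun ω n hn => ?_
  obtain ⟨j, k, h1, h2, h3⟩ := (detection_le_iff F lam Θ a ω n).1 hn.le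
  have h4 := (detection_le_iff F lam Θ a ω (j + k)).2 ⟨j, k, h1, le_rfl, h3⟩
  rw [hn] at h4
  -- Minimality of the stopping time: the window that triggers the alarm ends exactly at `n`, so its
  -- likelihood ratio is part of the statistic at `n`.
  obtain rfl : n = j + k := le_antisymm (by exact_mod_cast h4) h2
  refine le_trans ?_ (prod_le_srStat _ ω j h1)
  rw [← ENNReal.ofReal_prod_of_nonneg fun i _ => (Real.exp_pos _).le, ← Real.exp_sum]
  exact ENNReal.ofReal_le_ofReal (Real.exp_le_exp.2 (h3 θ hmem))

end Detection

theorem measurable_stopping_sub {N : SamplePath → ℕ∞} (hN : IsStoppingTime obsFiltration N)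
    (m : ℕ) : Measurable fun ω => ((N ω - m : ℕ∞) : ℝ≥0∞) := by
  simp only [enat_toENNReal_eq_tsum]
  refine Measurable.tsum fun k => Measurable.ite ?_ measurable_const measurable_const
  have e : {ω | (k : ℕ∞) < N ω - m} = {ω | ((m + k : ℕ) : ℕ∞) < N ω} := by
    ext ω
    simp only [Set.mem_ofPred_eq]
    rw [lt_tsub_iff_left]; push_cast; rfl
  rw [e]
  exact obsFiltration.le _ _ (measurableSet_lt_stopping hN _)

/-! ### Change-point laws and integrated delay bounds. -/

section Change

variable {F : Measure ℝ} {θ θ' lam : ℝ}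

theorem isProbabilityMeasure_changeFactor [IsProbabilityMeasure (obsLaw F θ)]
    [IsProbabilityMeasure (obsLaw F lam)] (m i : ℕ) :
    IsProbabilityMeasure (if i < m then obsLaw F θ else obsLaw F lam) := by
  split_ifs <;> infer_instance

instance isProbabilityMeasure_changeLaw [IsProbabilityMeasure (obsLaw F θ)]
    [IsProbabilityMeasure (obsLaw F lam)] (m : ℕ) :
    IsProbabilityMeasure (changeLaw F θ lam m) := by
  have := isProbabilityMeasure_changeFactor (F := F) (θ := θ) (lam := lam) m
  unfold changeLaw; infer_instance

instance isProbabilityMeasure_noChangeLaw [IsProbabilityMeasure (obsLaw F θ)] :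
    IsProbabilityMeasure (noChangeLaw F θ) := by
  unfold noChangeLaw; infer_instance

variable [IsProbabilityMeasure (obsLaw F θ)] [IsProbabilityMeasure (obsLaw F lam)]

theorem changeLaw_eq_noChangeLaw {n : ℕ} {s : Set SamplePath}
    (hs : MeasurableSet[obsFiltration n] s) : changeLaw F θ lam n s = noChangeLaw F θ s := by
  have := isProbabilityMeasure_changeFactor (F := F) (θ := θ) (lam := lam) n
  exact infinitePi_congr_past _ _ (fun i hi => if_pos hi) hs

theorem changeLaw_delay {m n : ℕ} (hmn : m ≤ n) :
    changeLaw F θ lam n = (changeLaw F θ lam m).withDensity fun ω =>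
      ∏ i ∈ Finset.Ico m n, ENNReal.ofReal (Real.exp (logLR F θ lam (ω i))) := by
  have h1 := isProbabilityMeasure_changeFactor (F := F) (θ := θ) (lam := lam) m
  have h2 := isProbabilityMeasure_changeFactor (F := F) (θ := θ) (lam := lam) n
  refine infinitePi_withDensity _ _ _
    (fun _ x => ENNReal.ofReal (Real.exp (logLR F θ lam x)))
    (fun _ => (measurable_logLR F θ lam).exp.ennreal_ofReal) (fun i hi => ?_) fun i hi => ?_
  · rw [Finset.mem_Ico] at hi
    rw [if_pos hi.2, if_neg (by omega), ← obsLaw_withDensity]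
  · rw [Finset.mem_Ico] at hi
    by_cases h : i < m
    · rw [if_pos h, if_pos (by omega)]
    · rw [if_neg h, if_neg (by omega)]

/-- The density involves only the first `m` observations; this is what lets a delay bound for `θ'`
be transferred to `θ`. -/
theorem changeLaw_base [IsProbabilityMeasure (obsLaw F θ')] (m : ℕ) :
    changeLaw F θ lam m = (changeLaw F θ' lam m).withDensity fun ω =>
      ∏ i ∈ Finset.range m, ENNReal.ofReal (Real.exp (logLR F θ θ' (ω i))) := by
  have h1 := isProbabilityMeasure_changeFactor (F := F) (θ := θ) (lam := lam) m
  have h2 := isProbabilityMeasure_changeFactor (F := F) (θ := θ') (lam := lam) m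
  refine infinitePi_withDensity _ _ _
    (fun _ x => ENNReal.ofReal (Real.exp (logLR F θ θ' x)))
    (fun _ => (measurable_logLR F θ θ').exp.ennreal_ofReal) (fun i hi => ?_) fun i hi => ?_
  · rw [Finset.mem_range] at hi
    rw [if_pos hi, if_pos hi, ← obsLaw_withDensity]
  · rw [Finset.mem_range] at hi
    rw [if_neg hi, if_neg hi]

/-- Change of measure from the change-point law to the law without a change. -/
theorem integral_indicator_likelihood {m n : ℕ} (hmn : m ≤ n) {s : Set SamplePath}
    (hs : MeasurableSet[obsFiltration n] s) :
    Integrable (s.indicator fun ω => Real.exp (-∑ i ∈ Finset.Ico m n, logLR F lam θ (ω i)))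
      (changeLaw F θ lam m) ∧
    ∫ ω, s.indicator (fun ω => Real.exp (-∑ i ∈ Finset.Ico m n, logLR F lam θ (ω i))) ω
      ∂changeLaw F θ lam m = (noChangeLaw F θ).real s := by
  have hs' := obsFiltration.le n s hs
  have hm : Measurable fun ω : SamplePath =>
      Real.exp (-∑ i ∈ Finset.Ico m n, logLR F lam θ (ω i)) :=
    (Finset.measurable_sum _ fun i _ =>
      (measurable_logLR F lam θ).comp (measurable_pi_apply i)).neg.exp
  have h0 : ∀ ω, 0 ≤ s.indicator
      (fun ω => Real.exp (-∑ i ∈ Finset.Ico m n, logLR F lam θ (ω i))) ω :=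
    fun ω => Set.indicator_nonneg (fun _ _ => (Real.exp_pos _).le) ω
  have key : ∫⁻ ω, ENNReal.ofReal (s.indicator
      (fun ω => Real.exp (-∑ i ∈ Finset.Ico m n, logLR F lam θ (ω i))) ω)
      ∂changeLaw F θ lam m = noChangeLaw F θ s := by
    rw [← changeLaw_eq_noChangeLaw (lam := lam) hs, changeLaw_delay hmn,
      withDensity_apply _ hs', ← lintegral_indicator hs']
    refine lintegral_congr fun ω => ?_
    by_cases h : ω ∈ s
    · rw [Set.indicator_of_mem h, Set.indicator_of_mem h,
        ← ENNReal.ofReal_prod_of_nonneg fun i _ => (Real.exp_pos _).le, ← Real.exp_sum]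
      simp only [logLR_neg F θ lam, Finset.sum_neg_distrib]
    · rw [Set.indicator_of_notMem h, Set.indicator_of_notMem h, ENNReal.ofReal_zero]
  have hae := (hm.indicator hs').aestronglyMeasurable (μ := changeLaw F θ lam m)
  refine ⟨⟨hae, ?_⟩, ?_⟩
  · rw [hasFiniteIntegral_iff_ofReal (ae_of_all _ h0), key]
    exact measure_lt_top _ _
  · rw [integral_eq_lintegral_of_nonneg_ae (ae_of_all _ h0) hae, key]
    rfl

/-- On the σ-algebra of the first `m` observations, the measure with the delay as density is
dominated by `B` times the law, because the conditional mean of the delay is a.e. at most `B`; then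
`h` is integrated against both. -/
theorem lintegral_mul_delay_le {N : SamplePath → ℕ∞} {B : ℝ≥0∞}
    (hB : worstDelay F θ lam N ≤ B) (m : ℕ) {h : SamplePath → ℝ≥0∞}
    (hh : Measurable[obsFiltration m] h) (hN : IsStoppingTime obsFiltration N) :
    ∫⁻ ω, h ω * ((N ω - m : ℕ∞) : ℝ≥0∞) ∂changeLaw F θ lam m ≤
      B * ∫⁻ ω, h ω ∂changeLaw F θ lam m := by
  set P := changeLaw F θ lam m
  set X : SamplePath → ℝ≥0∞ := fun ω => ((N ω - m : ℕ∞) : ℝ≥0∞)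
  have hX : Measurable X := measurable_stopping_sub hN m
  have hle := obsFiltration.le m
  have hh' : Measurable h := hh.mono hle le_rfl
  have h1 : ∀ᵐ ω ∂P, condLExp (obsFiltration m) P X ω ≤ B := by
    filter_upwards [ae_le_essSup (f := condLExp (obsFiltration m) P X) (μ := P)] with ω hω
    exact hω.trans ((le_iSup (fun m : ℕ => essSup (condLExp (obsFiltration m)
      (changeLaw F θ lam m) fun ω => ((N ω - (m : ℕ∞) : ℕ∞) : ℝ≥0∞))
      (changeLaw F θ lam m)) m).trans hB)
  have h2 : (P.withDensity X).trim hle ≤ (B • P).trim hle := by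
    refine Measure.le_iff.2 fun s hs => ?_
    rw [trim_measurableSet_eq hle hs, trim_measurableSet_eq hle hs,
      withDensity_apply _ (hle s hs), ← setLIntegral_condLExp hle P X hs,
      Measure.smul_apply, smul_eq_mul, ← setLIntegral_const]
    exact lintegral_mono_ae (ae_restrict_of_ae h1)
  have h3 := lintegral_mono' h2 (le_refl h)
  rw [lintegral_trim hle hh, lintegral_trim hle hh, lintegral_smul_measure,
    lintegral_withDensity_eq_lintegral_mul _ hX hh'] at h3
  rw [smul_eq_mul] at h3
  exact le_trans (le_of_eq (lintegral_congr fun ω => mul_comm _ _)) h3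

theorem setLIntegral_delay_le [IsProbabilityMeasure (obsLaw F θ')] {N : SamplePath → ℕ∞}
    {B : ℝ≥0∞} (hB : worstDelay F θ' lam N ≤ B) (hN : IsStoppingTime obsFiltration N) {m : ℕ}
    {s : Set SamplePath} (hs : MeasurableSet[obsFiltration m] s) :
    ∫⁻ ω in s, ((N ω - m : ℕ∞) : ℝ≥0∞) ∂changeLaw F θ lam m ≤ B * noChangeLaw F θ s := by
  have hs' := obsFiltration.le m s hs
  have hd : Measurable[obsFiltration m] fun ω : SamplePath =>
      ∏ i ∈ Finset.range m, ENNReal.ofReal (Real.exp (logLR F θ θ' (ω i))) :=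
    Finset.measurable_prod _ fun i hi => (measurable_logLR F θ θ').exp.ennreal_ofReal.comp
      (measurable_obs (Finset.mem_range.1 hi))
  have hd' := hd.mono (obsFiltration.le m) le_rfl
  -- The weight is the density of `θ` against `θ'` restricted to `s`, which turns the bound under
  -- `θ'` into one under `θ`.
  have key := lintegral_mul_delay_le hB m (@Measurable.indicator _ _ (_) _ _ _ _ hd hs) hN
  rw [lintegral_indicator hs', ← withDensity_apply _ hs', ← changeLaw_base,
    changeLaw_eq_noChangeLaw hs] at key
  refine le_trans (le_of_eq ?_) key
  rw [changeLaw_base (θ := θ) (θ' := θ') m, restrict_withDensity hs',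
    lintegral_withDensity_eq_lintegral_mul _ hd' (measurable_stopping_sub hN m),
    ← lintegral_indicator hs']
  refine lintegral_congr fun ω => ?_
  by_cases h : ω ∈ s <;> simp [h]

end Change

/-! ### Information bound for arbitrary stopping times. -/

section Optimality

variable {F : Measure ℝ} {θ θ' lam : ℝ}

/-- A tangent-line bound, used with `z` a log-likelihood ratio: the reverse likelihood ratio
`exp(-z)` integrates to a `P_θ`-probability. It plays the role of Jensen's inequality for relative
entropy, with `c` free to be optimized. -/
theorem one_add_log_sub_le {c : ℝ} (hc : 0 < c) (z : ℝ) :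
    1 + Real.log c - c * Real.exp (-z) ≤ z := by
  have h : c * Real.exp (-z) = Real.exp (Real.log c - z) := by
    rw [sub_eq_add_neg, Real.exp_add, Real.exp_log hc]
  have := Real.add_one_le_exp (Real.log c - z)
  linarith

/-- Pathwise lower bound for the log-likelihood ratio stopped at `N ∧ (m + t)`. -/
theorem stopped_logLR_ge {c : ℝ} (hc : 0 < c) (y : ℕ → ℝ) (N : ℕ∞) (m t : ℕ) :
    ∑ k ∈ Finset.range t, (if N = ((m + k + 1 : ℕ) : ℕ∞) then
        1 + Real.log c - c * Real.exp (-∑ i ∈ Finset.Ico m (m + k + 1), y i) else 0) +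
      (if ((m + t : ℕ) : ℕ∞) < N then
        1 - Real.exp (-∑ i ∈ Finset.Ico m (m + t), y i) else 0) ≤
    ∑ k ∈ Finset.range t, if ((m + k : ℕ) : ℕ∞) < N then y (m + k) else 0 := by
  have hW : ∀ s ≤ t, (∀ k, k < s → ((m + k : ℕ) : ℕ∞) < N) →
      (∀ k, s ≤ k → k < t → ¬ ((m + k : ℕ) : ℕ∞) < N) →
      ∑ k ∈ Finset.range t, (if ((m + k : ℕ) : ℕ∞) < N then y (m + k) else 0) =
        ∑ i ∈ Finset.Ico m (m + s), y i := by
    intro s hs h1 h2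
    rw [Finset.sum_Ico_eq_sum_range, Nat.add_sub_cancel_left,
      ← Finset.sum_subset (Finset.range_mono hs)]
    · exact Finset.sum_congr rfl fun k hk => if_pos (h1 k (Finset.mem_range.1 hk))
    · exact fun k hk hk' => if_neg (h2 k (by simpa using hk') (by simpa using hk))
  -- Paths still running at `m + t` use the tangent bound with constant `1`, paths stopping inside
  -- the window use `c`, and for `N ≤ m` both sides vanish.
  by_cases hN : ((m + t : ℕ) : ℕ∞) < N
  · rw [if_pos hN, Finset.sum_eq_zero, zero_add, hW t le_rfl]
    · simpa using one_add_log_sub_le one_pos (∑ i ∈ Finset.Ico m (m + t), y i)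
    · exact fun k hk => lt_of_le_of_lt (by exact_mod_cast (by omega : m + k ≤ m + t)) hN
    · intro k hk hk'; omega
    · intro k hk
      rw [if_neg]
      rintro rfl
      have : m + t < m + k + 1 := by exact_mod_cast hN
      have := Finset.mem_range.1 hk
      omega
  · rw [if_neg hN, add_zero]
    obtain ⟨n, rfl⟩ := ENat.ne_top_iff_exists.1 (show N ≠ ⊤ by
      rintro rfl; exact hN (ENat.natCast_lt_top _))
    simp only [Nat.cast_lt, Nat.cast_inj] at hN hW ⊢
    rcases le_or_gt n m with h | h
    · rw [Finset.sum_eq_zero fun k _ => if_neg (by omega),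
        Finset.sum_eq_zero fun k _ => if_neg (by omega)]
    · rw [hW (n - m) (by omega) (fun k hk => by omega) fun k hk hk' => by omega,
        Finset.sum_eq_single (n - m - 1) (fun k _ hk => if_neg (by omega))
          (fun hk => absurd (Finset.mem_range.2 (by omega)) hk),
        if_pos (by omega), (by omega : m + (n - m - 1) + 1 = m + (n - m))]
      exact one_add_log_sub_le hc _

variable [IsProbabilityMeasure (obsLaw F θ)] [IsProbabilityMeasure (obsLaw F lam)]

/-- The pathwise bound is integrated under the law with change after `m`. Wald's identity evaluates
the right side, and change of measure turns the exponentials on the left into `P_θ`-probabilities.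
-/
theorem information_le (hY : Integrable (logLR F lam θ) (obsLaw F lam)) {N : SamplePath → ℕ∞}
    (hN : IsStoppingTime obsFiltration N) {c : ℝ} (hc : 0 < c) (m t : ℕ) :
    Real.log c * ((noChangeLaw F θ).real {ω | (m : ℕ∞) < N ω} -
        (changeLaw F θ lam m).real {ω | ((m + t : ℕ) : ℕ∞) < N ω}) -
      c * ((noChangeLaw F θ).real {ω | (m : ℕ∞) < N ω} -
        (noChangeLaw F θ).real {ω | ((m + t : ℕ) : ℕ∞) < N ω}) -
      (noChangeLaw F θ).real {ω | ((m + t : ℕ) : ℕ∞) < N ω} ≤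
    klInfo F lam θ * ∑ k ∈ Finset.range t,
      (changeLaw F θ lam m).real {ω | ((m + k : ℕ) : ℕ∞) < N ω} := by
  set P := noChangeLaw F θ
  set Q := changeLaw F θ lam m
  have hfac := isProbabilityMeasure_changeFactor (F := F) (θ := θ) (lam := lam) m
  have hlt : ∀ n : ℕ, MeasurableSet {ω | (n : ℕ∞) < N ω} := fun n =>
    obsFiltration.le n _ (measurableSet_lt_stopping hN n)
  have heq : ∀ n : ℕ, MeasurableSet {ω | N ω = (n : ℕ∞)} := fun n =>
    obsFiltration.le n _ (measurableSet_eq_stopping hN n)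
  -- the event that the stopping time takes a given value
  have hdiff : ∀ (R : Measure SamplePath) [IsProbabilityMeasure R] (n : ℕ),
      R.real {ω | N ω = ((n + 1 : ℕ) : ℕ∞)} =
        R.real {ω | (n : ℕ∞) < N ω} - R.real {ω | ((n + 1 : ℕ) : ℕ∞) < N ω} := by
    intro R _ n
    have hcast : ((n + 1 : ℕ) : ℕ∞) = (n : ℕ∞) + 1 := by push_cast; rfl
    have hsub : {ω | ((n + 1 : ℕ) : ℕ∞) < N ω} ⊆ {ω | (n : ℕ∞) < N ω} := fun ω hω =>
      lt_of_le_of_lt (b := ((n + 1 : ℕ) : ℕ∞)) (by exact_mod_cast n.le_succ) hω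
    rw [← measureReal_sdiff hsub (hlt _)]
    congr 1
    ext ω
    simp only [Set.mem_ofPred_eq, Set.mem_sdiff, not_lt]
    rw [hcast, ← ENat.add_one_le_iff (ENat.natCast_ne_top n), le_antisymm_iff, and_comm]
  have hsum : ∀ (R : Measure SamplePath) [IsProbabilityMeasure R],
      ∑ k ∈ Finset.range t, R.real {ω | N ω = ((m + k + 1 : ℕ) : ℕ∞)} =
        R.real {ω | (m : ℕ∞) < N ω} - R.real {ω | ((m + t : ℕ) : ℕ∞) < N ω} := by
    intro R _
    rw [Finset.sum_congr rfl fun k _ => hdiff R (m + k)]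
    exact Finset.sum_range_sub' (fun k => R.real {ω | ((m + k : ℕ) : ℕ∞) < N ω}) t
  have hYm := measurable_logLR F lam θ
  -- integral of the right side
  have hWi : ∀ k, Integrable ({ω | ((m + k : ℕ) : ℕ∞) < N ω}.indicator
      fun ω : SamplePath => logLR F lam θ (ω (m + k))) Q := fun k => by
    refine Integrable.indicator ?_ (hlt _)
    refine integrable_infinitePi_eval _ (m + k) ?_
    rw [if_neg (by omega)]; exact hY
  have hWint : ∀ k, ∫ ω, {ω | ((m + k : ℕ) : ℕ∞) < N ω}.indicator
      (fun ω : SamplePath => logLR F lam θ (ω (m + k))) ω ∂Q =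
        Q.real {ω | ((m + k : ℕ) : ℕ∞) < N ω} * klInfo F lam θ := fun k => by
    have h := integral_indicator_obs (fun i => if i < m then obsLaw F θ else obsLaw F lam)
      (measurableSet_lt_stopping hN (m + k)) hYm
    rw [if_neg (by omega)] at h
    exact h
  -- integrals of the left side
  have hlik := fun k => integral_indicator_likelihood (F := F) (θ := θ) (lam := lam)
    (show m ≤ m + k + 1 by omega) (measurableSet_eq_stopping hN (m + k + 1))
  have hlikt := integral_indicator_likelihood (F := F) (θ := θ) (lam := lam)
    (show m ≤ m + t by omega) (measurableSet_lt_stopping hN (m + t))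
  set E : ℕ → SamplePath → ℝ := fun n ω =>
    Real.exp (-∑ i ∈ Finset.Ico m n, logLR F lam θ (ω i)) with hE
  have hc1 : ∀ s : Set SamplePath, MeasurableSet s → ∀ d : ℝ,
      Integrable (s.indicator fun _ => d) Q := fun s hs d =>
    (integrable_const d).indicator hs
  have hAi : ∀ k, Integrable (fun ω => {ω | N ω = ((m + k + 1 : ℕ) : ℕ∞)}.indicator
      (fun _ => 1 + Real.log c) ω -
      c * {ω | N ω = ((m + k + 1 : ℕ) : ℕ∞)}.indicator (E (m + k + 1)) ω) Q := fun k =>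
    (hc1 _ (heq _) _).sub ((hlik k).1.const_mul c)
  have hBi : Integrable (fun ω => {ω | ((m + t : ℕ) : ℕ∞) < N ω}.indicator
      (fun _ => (1 : ℝ)) ω - {ω | ((m + t : ℕ) : ℕ∞) < N ω}.indicator (E (m + t)) ω) Q :=
    (hc1 _ (hlt _) _).sub hlikt.1
  have hAint : ∀ k, ∫ ω, ({ω | N ω = ((m + k + 1 : ℕ) : ℕ∞)}.indicator
      (fun _ => 1 + Real.log c) ω -
      c * {ω | N ω = ((m + k + 1 : ℕ) : ℕ∞)}.indicator (E (m + k + 1)) ω) ∂Q =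
      (1 + Real.log c) * Q.real {ω | N ω = ((m + k + 1 : ℕ) : ℕ∞)} -
        c * P.real {ω | N ω = ((m + k + 1 : ℕ) : ℕ∞)} := fun k => by
    rw [integral_sub (hc1 _ (heq _) _) ((hlik k).1.const_mul c), integral_const_mul,
      (hlik k).2, integral_indicator_const _ (heq _), smul_eq_mul, mul_comm (1 + _)]
  have hBint : ∫ ω, ({ω | ((m + t : ℕ) : ℕ∞) < N ω}.indicator
      (fun _ => (1 : ℝ)) ω - {ω | ((m + t : ℕ) : ℕ∞) < N ω}.indicator (E (m + t)) ω) ∂Q =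
      Q.real {ω | ((m + t : ℕ) : ℕ∞) < N ω} - P.real {ω | ((m + t : ℕ) : ℕ∞) < N ω} := by
    rw [integral_sub (hc1 _ (hlt _) _) hlikt.1, hlikt.2,
      integral_indicator_const _ (hlt _), smul_eq_mul, mul_one]
  have hmono : ∫ ω, (∑ k ∈ Finset.range t,
        ({ω | N ω = ((m + k + 1 : ℕ) : ℕ∞)}.indicator (fun _ => 1 + Real.log c) ω -
          c * {ω | N ω = ((m + k + 1 : ℕ) : ℕ∞)}.indicator (E (m + k + 1)) ω) +
        ({ω | ((m + t : ℕ) : ℕ∞) < N ω}.indicator (fun _ => (1 : ℝ)) ω -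
          {ω | ((m + t : ℕ) : ℕ∞) < N ω}.indicator (E (m + t)) ω)) ∂Q ≤
      ∫ ω, ∑ k ∈ Finset.range t, {ω | ((m + k : ℕ) : ℕ∞) < N ω}.indicator
        (fun ω : SamplePath => logLR F lam θ (ω (m + k))) ω ∂Q := by
    refine integral_mono ((integrable_finsetSum _ fun k _ => hAi k).add hBi)
      (integrable_finsetSum _ fun k _ => hWi k) fun ω => ?_
    refine le_trans (le_of_eq ?_) ((stopped_logLR_ge hc (fun i => logLR F lam θ (ω i))
      (N ω) m t).trans (le_of_eq ?_))
    · simp only [Set.indicator_apply, Set.mem_ofPred_eq, hE]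
      congr 1
      · refine Finset.sum_congr rfl fun k _ => ?_
        split_ifs <;> ring
      · split_ifs <;> ring
    · simp only [Set.indicator_apply, Set.mem_ofPred_eq]
  rw [integral_add (integrable_finsetSum _ fun k _ => hAi k) hBi,
    integral_finsetSum _ fun k _ => hAi k, integral_finsetSum _ fun k _ => hWi k, hBint] at hmono
  simp only [hAint, hWint] at hmono
  rw [Finset.sum_sub_distrib, ← Finset.mul_sum, ← Finset.mul_sum, ← Finset.sum_mul,
    hsum Q, hsum P] at hmono
  have hQP : Q.real {ω | (m : ℕ∞) < N ω} = P.real {ω | (m : ℕ∞) < N ω} := by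
    rw [measureReal_def, measureReal_def,
      changeLaw_eq_noChangeLaw (measurableSet_lt_stopping hN m)]
  rw [hQP] at hmono
  -- The constants `1` of the tangent bounds add up to the probability of `N > m`, which is simply
  -- dropped.
  have hpos : 0 ≤ P.real {ω | (m : ℕ∞) < N ω} := measureReal_nonneg
  linarith

/-- A stopping time with large mean has a time from which it is unlikely to stop soon. -/
theorem exists_conditional_alarm_le {P : Measure SamplePath} [IsProbabilityMeasure P]
    {N : SamplePath → ℕ∞} (hN : IsStoppingTime obsFiltration N) {g : ℝ} (hg : 0 < g)
    (hlt : ENNReal.ofReal g < ∫⁻ ω, (N ω : ℝ≥0∞) ∂P) (t : ℕ) :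
    ∃ m : ℕ, 0 < P.real {ω | (m : ℕ∞) < N ω} ∧
      P.real {ω | (m : ℕ∞) < N ω} - P.real {ω | ((m + t : ℕ) : ℕ∞) < N ω} ≤
        t / g * P.real {ω | (m : ℕ∞) < N ω} := by
  -- Otherwise `(t/g) p(m) ≤ p(m) - p(m+t)` for all `m`, with `p` the survival function. Summing
  -- over `m`, the right side telescopes to at most `t`, so the mean `∑ p` would be at most `g`.
  by_contra! hcon
  set p : ℕ → ℝ := fun n => P.real {ω | (n : ℕ∞) < N ω} with hp
  have hp0 : ∀ n, 0 ≤ p n := fun n => measureReal_nonneg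
  have hp1 : ∀ n, p n ≤ 1 := fun n => measureReal_le_one
  have hanti : ∀ a b : ℕ, a ≤ b → p b ≤ p a := fun a b hab =>
    measureReal_mono fun ω hω => lt_of_le_of_lt (b := (b : ℕ∞)) (by exact_mod_cast hab) hω
  have hstep : ∀ m, t / g * p m ≤ p m - p (m + t) := by
    intro m
    rcases (hp0 m).lt_or_eq with h | h
    · exact (hcon m h).le
    · have := hanti m (m + t) (by omega)
      rw [← h] at this ⊢; linarith
  rcases Nat.eq_zero_or_pos t with rfl | ht
  · by_cases h : ∃ m, 0 < p m
    · obtain ⟨m, hm⟩ := h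
      have := hcon m hm
      simp at this
    · push Not at h
      have : ∫⁻ ω, (N ω : ℝ≥0∞) ∂P = 0 := by
        rw [lintegral_stopping hN, ENNReal.tsum_eq_zero]
        intro k
        have := le_antisymm (h k) (hp0 k)
        exact (measureReal_eq_zero_iff (μ := P)).1 this
      rw [this] at hlt
      exact absurd hlt (by simp)
  have ht' : (0 : ℝ) < t := by exact_mod_cast ht
  have hsum : ∀ M : ℕ, ∑ k ∈ Finset.range M, p k ≤ g := by
    intro M
    have h1 : t / g * ∑ k ∈ Finset.range M, p k ≤
        ∑ k ∈ Finset.range M, p k - ∑ k ∈ Finset.range M, p (t + k) := by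
      rw [Finset.mul_sum, ← Finset.sum_sub_distrib]
      refine Finset.sum_le_sum fun k _ => ?_
      rw [add_comm t k]; exact hstep k
    have h2 := Finset.sum_range_add p t M
    have h3 : ∑ k ∈ Finset.range M, p k ≤ ∑ k ∈ Finset.range (t + M), p k :=
      Finset.sum_le_sum_of_subset_of_nonneg (Finset.range_mono (by omega)) fun k _ _ => hp0 k
    have h4 : ∑ k ∈ Finset.range t, p k ≤ t := by
      simpa using Finset.sum_le_sum fun k (_ : k ∈ Finset.range t) => hp1 k
    have h5 : t / g * ∑ k ∈ Finset.range M, p k ≤ t := by linarith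
    rw [div_mul_eq_mul_div, div_le_iff₀ hg] at h5
    exact le_of_mul_le_mul_left h5 ht'
  refine absurd hlt (not_lt.2 ?_)
  rw [lintegral_stopping hN]
  refine ENNReal.tsum_le_of_sum_range_le fun M => ?_
  have : ∀ k : ℕ, P {ω | (k : ℕ∞) < N ω} = ENNReal.ofReal (p k) := fun k => by
    rw [hp, ofReal_measureReal]
  simp only [this]
  rw [← ENNReal.ofReal_sum_of_nonneg fun k _ => hp0 k]
  exact ENNReal.ofReal_le_ofReal (hsum M)

variable [IsProbabilityMeasure (obsLaw F θ')]

/-- `information_le` is applied with `c = g/t`, so that the term with `c` costs at most `P_θ(N >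
m)`. Markov's inequality bounds the chance of a delay beyond `t` by `B/t` times that probability,
which is then divided out. The `2` collects the term with `c` and the `P_θ`-probability of `N > m +
t`. -/
theorem log_le_of_worstDelay_le (hY : Integrable (logLR F lam θ) (obsLaw F lam))
    (hI : 0 ≤ klInfo F lam θ) {N : SamplePath → ℕ∞} (hN : IsStoppingTime obsFiltration N)
    {B : ℝ} (hB0 : 0 ≤ B) (hB : worstDelay F θ' lam N ≤ ENNReal.ofReal B) {t : ℕ} (ht : 0 < t)
    {g : ℝ} (hg : (t : ℝ) ≤ g) (hlt : ENNReal.ofReal g < longARL F θ N) :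
    (1 - B / t) * Real.log (g / t) ≤ klInfo F lam θ * B + 2 := by
  have ht' : (0 : ℝ) < t := by exact_mod_cast ht
  have hg0 : 0 < g := ht'.trans_le hg
  obtain ⟨m, hm, hcond⟩ := exists_conditional_alarm_le hN hg0 hlt t
  have hinf := information_le hY hN (div_pos hg0 ht') m t
  set p : ℕ → ℝ := fun n => (noChangeLaw F θ).real {ω | (n : ℕ∞) < N ω} with hp
  set q : ℕ → ℝ := fun n => (changeLaw F θ lam m).real {ω | (n : ℕ∞) < N ω} with hq
  change 0 < p m at hm
  change p m - p (m + t) ≤ t / g * p m at hcond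
  change Real.log (g / t) * (p m - q (m + t)) - g / t * (p m - p (m + t)) - p (m + t) ≤
    klInfo F lam θ * ∑ k ∈ Finset.range t, q (m + k) at hinf
  have hanti : ∀ a b : ℕ, a ≤ b → {ω | (b : ℕ∞) < N ω} ⊆ {ω | (a : ℕ∞) < N ω} :=
    fun a b hab ω hω => lt_of_le_of_lt (b := (b : ℕ∞)) (by exact_mod_cast hab) hω
  have hltm : ∀ n : ℕ, MeasurableSet {ω | (n : ℕ∞) < N ω} := fun n =>
    obsFiltration.le n _ (measurableSet_lt_stopping hN n)
  have hdelay : ∑ k ∈ Finset.range t, q (m + k) ≤ B * p m := by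
    have h1 := setLIntegral_delay_le (θ := θ) hB hN (measurableSet_lt_stopping hN m)
    have h2 : ∑ k ∈ Finset.Ico m (m + t), changeLaw F θ lam m {ω | (k : ℕ∞) < N ω} ≤
        ∫⁻ ω in {ω | (m : ℕ∞) < N ω}, ((N ω - m : ℕ∞) : ℝ≥0∞) ∂changeLaw F θ lam m := by
      refine le_trans (le_of_eq ?_) (lintegral_mono fun ω => sum_lt_le_sub (N ω) m t)
      rw [lintegral_finsetSum _ fun k _ =>
        Measurable.ite (hltm k) measurable_const measurable_const]
      refine Finset.sum_congr rfl fun k hk => ?_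
      have hk := (Finset.mem_Ico.1 hk).1
      have : (fun ω => if (k : ℕ∞) < N ω then (1 : ℝ≥0∞) else 0) =
          {ω | (k : ℕ∞) < N ω}.indicator 1 := by
        ext ω; simp [Set.indicator_apply]
      rw [this, lintegral_indicator_one (hltm k), Measure.restrict_apply (hltm k),
        Set.inter_eq_left.2 (hanti m k hk)]
    have h3 := h2.trans h1
    rw [Finset.sum_Ico_eq_sum_range, Nat.add_sub_cancel_left] at h3
    have h4 : ∀ n : ℕ, changeLaw F θ lam m {ω | (n : ℕ∞) < N ω} = ENNReal.ofReal (q n) :=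
      fun n => (ofReal_measureReal).symm
    have h5 : noChangeLaw F θ {ω | (m : ℕ∞) < N ω} = ENNReal.ofReal (p m) :=
      (ofReal_measureReal).symm
    simp only [h4] at h3
    rw [h5, ← ENNReal.ofReal_sum_of_nonneg fun k _ => measureReal_nonneg,
      ← ENNReal.ofReal_mul hB0] at h3
    exact (ENNReal.ofReal_le_ofReal_iff (mul_nonneg hB0 hm.le)).1 h3
  have hq : t * q (m + t) ≤ B * p m := by
    refine le_trans ?_ hdelay
    have := Finset.sum_le_sum fun k (hk : k ∈ Finset.range t) =>
      (measureReal_mono (hanti (m + k) (m + t)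
        (by have := Finset.mem_range.1 hk; omega)) : q (m + t) ≤ q (m + k))
    rw [Finset.sum_const, Finset.card_range, nsmul_eq_mul] at this
    exact this
  have hq' : q (m + t) ≤ B / t * p m := by
    rw [div_mul_eq_mul_div, le_div_iff₀ ht']; linarith
  have hlog : 0 ≤ Real.log (g / t) := Real.log_nonneg ((one_le_div ht').2 hg)
  have hc : g / t * (p m - p (m + t)) ≤ p m := by
    calc g / t * (p m - p (m + t)) ≤ g / t * (t / g * p m) := by gcongr
      _ = p m := by field_simp
  have hpm : p (m + t) ≤ p m := measureReal_mono (hanti m (m + t) (by omega))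
  have h1 := mul_le_mul_of_nonneg_left hdelay hI
  have h2 := mul_le_mul_of_nonneg_left hq' hlog
  have h3 : ((1 - B / t) * Real.log (g / t)) * p m ≤ (klInfo F lam θ * B + 2) * p m := by
    nlinarith
  exact le_of_mul_le_mul_right h3 hm

/-- Upper bound for the mean time to a false alarm of any procedure with a given worst case
delay. -/
theorem longARL_le_of_worstDelay_le (hY : Integrable (logLR F lam θ) (obsLaw F lam))
    (hI : 0 ≤ klInfo F lam θ) {N : SamplePath → ℕ∞} (hN : IsStoppingTime obsFiltration N)
    {B : ℝ} (hB2 : 2 ≤ B) (hB : worstDelay F θ' lam N ≤ ENNReal.ofReal B) :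
    longARL F θ N ≤ ENNReal.ofReal (Real.exp
      (klInfo F lam θ * B + (2 * klInfo F lam θ + 5 + 2 * Real.log B))) := by
  set I := klInfo F lam θ
  set x := I * B + (2 * I + 5 + 2 * Real.log B)
  by_contra! hcon
  obtain ⟨g', hg1, hg2⟩ := ENNReal.lt_iff_exists_nnreal_btwn.1 hcon
  set g : ℝ := NNReal.toReal g'
  have hgx : Real.exp x < g := by
    rw [← ENNReal.ofReal_coe_nnreal, ENNReal.ofReal_lt_ofReal_iff_of_nonneg
      (Real.exp_pos _).le] at hg1
    exact hg1
  rw [← ENNReal.ofReal_coe_nnreal] at hg2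
  -- Long enough for `B/t ≤ 1/B`, which makes the loss of information bounded, and short enough for
  -- `log t ≤ 1 + 2 log B`.
  set t := ⌈B ^ 2⌉₊
  have hB0 : 0 < B := by linarith
  have htB : B ^ 2 ≤ t := Nat.le_ceil _
  have ht0 : (0 : ℝ) < t := lt_of_lt_of_le (by positivity) htB
  have ht2 : (t : ℝ) ≤ 2 * B ^ 2 := by
    have := (Nat.ceil_lt_add_one (sq_nonneg B)).le
    nlinarith
  have hlogt : Real.log t ≤ 1 + 2 * Real.log B := by
    have h1 := Real.log_le_log ht0 ht2
    rw [Real.log_mul two_ne_zero (by positivity), Real.log_pow] at h1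
    have := Real.log_two_lt_d9
    push_cast at h1
    linarith
  have hlogB : 0 ≤ Real.log B := Real.log_nonneg (by linarith)
  have hlogg : x < Real.log g := by
    rwa [Real.lt_log_iff_exp_lt ((Real.exp_pos x).trans hgx)]
  have htg : (t : ℝ) ≤ g := by
    refine le_trans ?_ hgx.le
    rw [← Real.log_le_iff_le_exp ht0]
    have := mul_nonneg hI hB0.le
    simp only [x]; linarith
  have key := log_le_of_worstDelay_le hY hI hN hB0.le hB (Nat.cast_pos.1 ht0) htg hg2
  rw [Real.log_div (ht0.trans_le htg).ne' ht0.ne'] at key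
  have hBt : B / t ≤ 1 / B := by
    rw [div_le_div_iff₀ ht0 hB0]; nlinarith
  have hB' : 1 / B ≤ 1 / 2 := one_div_le_one_div_of_le two_pos hB2
  -- Of the constant `2I + 5`, the bound on `log t` uses `1`. The factor `1 - 1/B` then takes `I`
  -- off `I * B` and at most half of `2I + 4`, leaving at least `I * B + 2`, against `key`.
  have hd : I * B + 2 * I + 4 < Real.log g - Real.log t := by
    simp only [x] at hlogg; linarith
  have hpos : 0 ≤ I * B + 2 * I + 4 := by have := mul_nonneg hI hB0.le; linarith
  have h1 : (1 - 1 / B) * (I * B + 2 * I + 4) < (1 - B / t) * (Real.log g - Real.log t) :=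
    mul_lt_mul' (by linarith) hd hpos (by linarith)
  have h2 : (1 / B) * (I * B) = I := by field_simp
  have h3 : (1 / B) * (2 * I + 4) ≤ 1 / 2 * (2 * I + 4) :=
    mul_le_mul_of_nonneg_right hB' (by linarith)
  nlinarith

end Optimality

/-! ### Reduction of the worst delay to one open-ended test. -/

section Delay

variable {F : Measure ℝ} {lam : ℝ}

/-- The copy of the test started right after observation `m` sees only post-change observations and
is independent of the past, so its conditional mean is the constant `E_lam T`; the minimum over all
copies is no later. -/
theorem worstDelay_detection_le {θ' : ℝ} [IsProbabilityMeasure (obsLaw F θ')]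
    [IsProbabilityMeasure (obsLaw F lam)] (Θ : Set ℝ) (a : ℝ) :
    worstDelay F θ' lam (detection F lam Θ a) ≤ longARL F lam (openEndedTest F lam Θ a) := by
  refine iSup_le fun m => ?_
  have hfac := isProbabilityMeasure_changeFactor (F := F) (θ := θ') (lam := lam) m
  set T := openEndedTest F lam Θ a
  have hT : Measurable fun ω => (T ω : ℝ≥0∞) := by
    simpa using measurable_stopping_sub (isStoppingTime_openEndedTest F lam Θ a) 0
  have h1 : (fun _ => longARL F lam T) =ᵐ[changeLaw F θ' lam m]
      condLExp (obsFiltration m) (changeLaw F θ' lam m)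
        fun ω => (T (fun i => ω (i + m)) : ℝ≥0∞) := by
    refine ae_eq_condLExp (obsFiltration.le m) _ _ measurable_const fun s hs => ?_
    rw [setLIntegral_const]
    have := setLIntegral_shift (fun i => if i < m then obsLaw F θ' else obsLaw F lam) hs hT
    refine Eq.trans ?_ this.symm
    simp only [not_lt.2 (Nat.le_add_left m _), if_false]
    rw [mul_comm]; rfl
  have h2 : condLExp (obsFiltration m) (changeLaw F θ' lam m)
      (fun ω => ((detection F lam Θ a ω - (m : ℕ∞) : ℕ∞) : ℝ≥0∞)) ≤ᵐ[changeLaw F θ' lam m]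
      condLExp (obsFiltration m) (changeLaw F θ' lam m)
        fun ω => (T (fun i => ω (i + m)) : ℝ≥0∞) := by
    refine condLExp_mono (ae_of_all _ fun ω => ?_)
    refine ENat.toENNReal_le.2 (tsub_le_iff_right.2 ?_)
    exact iInf_le (fun j : ℕ => T (fun i => ω (i + j)) + (j : ℕ∞)) m
  refine essSup_le_of_ae_le _ ?_
  filter_upwards [h1, h2] with ω h1 h2
  exact h2.trans h1.symm.le

end Delay

/-! ### Wald's inequality with capped increments. -/

section Wald

/-- The truncated increments made while a walk stays below `b` add up to at most the initial
deficit plus the truncation level. -/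
theorem sum_truncated_le (y : ℕ → ℝ) (b : ℝ) {K : ℝ} (hK : 0 ≤ K) (n M : ℕ) :
    ∑ k ∈ Finset.range M, (if ∀ j, n ≤ j → j ≤ n + k → ∑ i ∈ Finset.range j, y i < b
      then min (y (n + k)) K else 0) ≤ max (b - ∑ i ∈ Finset.range n, y i) 0 + K := by
  set S : ℕ → ℝ := fun j => ∑ i ∈ Finset.range j, y i with hS
  -- The first claim is the induction invariant before crossing. The last increment that counts
  -- starts below `b` and is capped at `K`, which bounds the overshoot.
  suffices h : ((∀ j, n ≤ j → j < n + M → S j < b) →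
      ∑ k ∈ Finset.range M, (if ∀ j, n ≤ j → j ≤ n + k → S j < b
        then min (y (n + k)) K else 0) ≤ S (n + M) - S n) ∧
      ∑ k ∈ Finset.range M, (if ∀ j, n ≤ j → j ≤ n + k → S j < b
        then min (y (n + k)) K else 0) ≤ max (b - S n) 0 + K from h.2
  induction M with
  | zero =>
    have := le_max_right (b - S n) 0
    simp only [Finset.range_zero, Finset.sum_empty, add_zero, sub_self, le_refl, implies_true,
      true_and]
    linarith
  | succ M ih =>
    simp only [Finset.sum_range_succ]
    have hSM : S (n + (M + 1)) = S (n + M) + y (n + M) := by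
      rw [← add_assoc]; exact Finset.sum_range_succ _ _
    refine ⟨fun h => ?_, ?_⟩
    · have h1 := ih.1 fun j hj hj' => h j hj (by omega)
      rw [if_pos fun j hj hj' => h j hj (by omega)]
      have := min_le_left (y (n + M)) K
      linarith
    · by_cases h : ∀ j, n ≤ j → j ≤ n + M → S j < b
      · rw [if_pos h]
        have h1 := ih.1 fun j hj hj' => h j hj (by omega)
        have h2 := h (n + M) (by omega) le_rfl
        have := min_le_right (y (n + M)) K
        have := le_max_left (b - S n) 0
        linarith
      · rw [if_neg h, add_zero]; exact ih.2

variable {μ : Measure ℝ} [IsProbabilityMeasure μ]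

theorem measurableSet_stay_below {Y : ℝ → ℝ} (hY : Measurable Y) (b : ℝ) (n k : ℕ) :
    MeasurableSet[obsFiltration (n + k)] {ω : SamplePath | ∀ j, n ≤ j → j ≤ n + k →
      ∑ i ∈ Finset.range j, Y (ω i) < b} := by
  simp only [Set.ofPred_forall]
  refine MeasurableSet.iInter fun j => MeasurableSet.iInter fun _ =>
    MeasurableSet.iInter fun hj => ?_
  have h1 : Measurable[obsFiltration (n + k)]
      fun ω : SamplePath => ∑ i ∈ Finset.range j, Y (ω i) :=
    Finset.measurable_sum _ fun i hi => hY.comp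
      (measurable_obs (by have := Finset.mem_range.1 hi; omega))
  exact h1 measurableSet_Iio

/-- Whether the walk has stayed below `b` up to time `n + k` is independent of the next increment,
so each expected capped increment factors. The sum of probabilities counts the mean time below `b`
from `n` on, and capping removes any need for moments of the overshoot. -/
theorem truncated_wald {Y : ℝ → ℝ} (hY : Measurable Y) (hYi : Integrable Y μ) (b : ℝ) {K : ℝ}
    (hK : 0 ≤ K) (n M : ℕ) :
    (∫ x, min (Y x) K ∂μ) * ∑ k ∈ Finset.range M, (Measure.infinitePi fun _ : ℕ => μ).real
      {ω | ∀ j, n ≤ j → j ≤ n + k → ∑ i ∈ Finset.range j, Y (ω i) < b} ≤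
    ∫ ω, max (b - ∑ i ∈ Finset.range n, Y (ω i)) 0 ∂(Measure.infinitePi fun _ : ℕ => μ) + K := by
  set P := Measure.infinitePi fun _ : ℕ => μ
  have hYK : Integrable (fun x => min (Y x) K) μ := hYi.inf (integrable_const K)
  have hYKm : Measurable fun x => min (Y x) K := hY.min measurable_const
  set E : ℕ → Set SamplePath := fun k =>
    {ω | ∀ j, n ≤ j → j ≤ n + k → ∑ i ∈ Finset.range j, Y (ω i) < b} with hE
  have hEm : ∀ k, MeasurableSet (E k) := fun k =>
    obsFiltration.le _ _ (measurableSet_stay_below hY b n k)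
  have hi : ∀ k, Integrable ((E k).indicator fun ω => min (Y (ω (n + k))) K) P := fun k =>
    (integrable_infinitePi_eval (fun _ => μ) (n + k) hYK).indicator (hEm k)
  have hint : ∀ k, ∫ ω, (E k).indicator (fun ω => min (Y (ω (n + k))) K) ω ∂P =
      P.real (E k) * ∫ x, min (Y x) K ∂μ := fun k =>
    integral_indicator_obs (fun _ => μ) (measurableSet_stay_below hY b n k) hYKm
  have hS : Integrable (fun ω : SamplePath => max (b - ∑ i ∈ Finset.range n, Y (ω i)) 0) P :=
    ((integrable_const b).sub (integrable_finsetSum _ fun i _ =>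
      integrable_infinitePi_eval (fun _ => μ) i hYi)).pos_part
  have hmono : ∫ ω, ∑ k ∈ Finset.range M, (E k).indicator (fun ω => min (Y (ω (n + k))) K) ω ∂P ≤
      ∫ ω, (max (b - ∑ i ∈ Finset.range n, Y (ω i)) 0 + K) ∂P := by
    refine integral_mono (integrable_finsetSum _ fun k _ => hi k)
      (hS.add (integrable_const K)) fun ω => ?_
    refine le_trans (le_of_eq ?_) (sum_truncated_le (fun i => Y (ω i)) b hK n M)
    simp only [Set.indicator_apply, hE, Set.mem_ofPred_eq]
  rw [integral_finsetSum _ fun k _ => hi k, integral_add hS (integrable_const K)] at hmono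
  simp only [hint, ← Finset.sum_mul] at hmono
  rw [mul_comm]
  simpa using hmono

theorem tendsto_integral_min {Y : ℝ → ℝ} (hYi : Integrable Y μ) :
    Tendsto (fun n : ℕ => ∫ x, min (Y x) n ∂μ) atTop (𝓝 (∫ x, Y x ∂μ)) := by
  refine tendsto_integral_of_dominated_convergence (fun x => |Y x|)
    (fun n => (hYi.inf (integrable_const (n : ℝ))).aestronglyMeasurable) hYi.abs
    (fun n => ae_of_all _ fun x => ?_) (ae_of_all _ fun x => ?_)
  · have hn : (0 : ℝ) ≤ n := Nat.cast_nonneg n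
    rw [Real.norm_eq_abs]
    rcases le_total (Y x) n with h | h
    · rw [min_eq_left h]
    · rw [min_eq_right h, abs_of_nonneg hn]; exact h.trans (le_abs_self _)
  · obtain ⟨m, hm⟩ := exists_nat_ge (Y x)
    refine tendsto_const_nhds.congr' ?_
    filter_upwards [eventually_ge_atTop m] with n hn
    rw [min_eq_left (hm.trans (by exact_mod_cast hn))]

end Wald

/-! ### Mean of the open-ended test, in terms of the deficit at time `⌈a⌉`. -/

section TestMean

variable {F : Measure ℝ} [NeZero F] {lam θ₁ : ℝ}

/-- After time `a` the hypothesis closest to `lam` is the last to be rejected. -/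
theorem test_all_of_test {θ a s : ℝ} {n : ℕ} (hθ : Integrable (fun x => Real.exp (θ * x)) F)
    (hθ₁ : θ₁ ∈ interior (integrableExpSet id F))
    (hlam : lam ∈ interior (integrableExpSet id F)) (h1 : θ ≤ θ₁) (h2 : θ₁ < lam)
    (hn : a ≤ n)
    (h : klInfo F lam θ₁ * a ≤ (lam - θ₁) * s - n * (logNorm F lam - logNorm F θ₁)) :
    klInfo F lam θ * a ≤ (lam - θ) * s - n * (logNorm F lam - logNorm F θ) := by
  have hs := logNorm_slope_le hθ hθ₁ (integrable_exp_of_mem_interior hlam) h1 h2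
  rw [klInfo_eq hlam] at h ⊢
  set m := ∫ x, x ∂obsLaw F lam
  set d := logNorm F lam - logNorm F θ
  set d₁ := logNorm F lam - logNorm F θ₁
  have hp : 0 < lam - θ₁ := sub_pos.2 h2
  -- The criterion for `θ` reads `(n - a) d ≤ (lam - θ)(s - a m)`. Divided by `lam - θ`, it bounds
  -- `n - a` times a secant slope of `b`, and for `n ≥ a` the case `θ₁` is the strictest.
  have h3 : (n - a) * d₁ ≤ (lam - θ₁) * (s - a * m) := by linarith
  have h4 := mul_le_mul_of_nonneg_right h3 (by linarith : 0 ≤ lam - θ)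
  have h5 := mul_le_mul_of_nonneg_left hs (sub_nonneg.2 hn)
  have h6 : (lam - θ₁) * ((n - a) * d) ≤ (lam - θ₁) * ((lam - θ) * (s - a * m)) := by
    linarith
  have h7 := le_of_mul_le_mul_left h6 hp
  linarith

theorem longARL_openEndedTest_le {Θ : Set ℝ} (hθ₁ : θ₁ ∈ interior (integrableExpSet id F))
    (hlam : lam ∈ interior (integrableExpSet id F)) (h2 : θ₁ < lam)
    (hΘ : ∀ θ ∈ Θ, θ ≤ θ₁ ∧ Integrable (fun x => Real.exp (θ * x)) F) {a K : ℝ} (ha : 0 < a)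
    (hK : 0 ≤ K) (hpos : 0 < ∫ x, min (logLR F lam θ₁ x) K ∂obsLaw F lam) :
    longARL F lam (openEndedTest F lam Θ a) ≤ ENNReal.ofReal (⌈a⌉₊ +
      ((lam - θ₁) * ∫ ω, max (⌈a⌉₊ * (∫ x, x ∂obsLaw F lam) - ∑ i ∈ Finset.range ⌈a⌉₊, ω i) 0
        ∂noChangeLaw F lam + K) / ∫ x, min (logLR F lam θ₁ x) K ∂obsLaw F lam) := by
  have hprob := isProbabilityMeasure_obsLaw (integrable_exp_of_mem_interior hlam)
  have hst := isStoppingTime_openEndedTest F lam Θ a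
  set n := ⌈a⌉₊
  set m := ∫ x, x ∂obsLaw F lam
  have han : a ≤ n := Nat.le_ceil a
  set T := openEndedTest F lam Θ a
  set P := noChangeLaw F lam
  have hwald := truncated_wald (measurable_logLR F lam θ₁) (integrable_logLR hlam θ₁)
    (klInfo F lam θ₁ * a) hK n
  have hxi : ∀ i, Integrable (fun ω : SamplePath => ω i) P := fun i =>
    integrable_infinitePi_eval (fun _ => obsLaw F lam) i (integrable_obsLaw hlam)
  -- Raising the level from `I a` to `I n` only increases the deficit; the values of `b` then cancel
  -- and `lam - θ₁` factors out.
  have hdef : ∫ ω, max (klInfo F lam θ₁ * a - ∑ i ∈ Finset.range n, logLR F lam θ₁ (ω i)) 0 ∂P ≤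
      (lam - θ₁) * ∫ ω, max (n * m - ∑ i ∈ Finset.range n, ω i) 0 ∂P := by
    rw [← integral_const_mul]
    have hd : 0 ≤ lam - θ₁ := (sub_pos.2 h2).le
    refine integral_mono ?_ ?_ fun ω => ?_
    · exact ((integrable_const _).sub (integrable_finsetSum _ fun i _ =>
        integrable_infinitePi_eval (fun _ => obsLaw F lam) i
          (integrable_logLR hlam θ₁))).pos_part
    · exact (((integrable_const _).sub
        (integrable_finsetSum _ fun i _ => hxi i)).pos_part).const_mul _
    · have hkl := klInfo_nonneg hlam (integrable_exp_of_mem_interior hθ₁)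
      have := mul_nonneg (sub_nonneg.2 han) hkl
      simp only [sum_logLR]
      refine max_le ?_ (mul_nonneg hd (le_max_right _ _))
      refine le_trans ?_ (mul_le_mul_of_nonneg_left (le_max_left _ _) hd)
      rw [klInfo_eq hlam] at this ⊢
      linarith
  have hsub : ∀ k : ℕ, P {ω | ((n + k : ℕ) : ℕ∞) < T ω} ≤ ENNReal.ofReal (P.real
      {ω | ∀ j, n ≤ j → j ≤ n + k →
        ∑ i ∈ Finset.range j, logLR F lam θ₁ (ω i) < klInfo F lam θ₁ * a}) := by
    intro k
    rw [ofReal_measureReal]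
    refine measure_mono fun ω hω j hj hj' => ?_
    by_contra! hcon
    refine absurd (show ((n + k : ℕ) : ℕ∞) < T ω from hω) (not_lt.2 ?_)
    refine (openEndedTest_le_iff F lam Θ a ω (n + k)).2 ⟨j, ?_, hj', fun θ hθ => ?_⟩
    · exact (Nat.one_le_iff_ne_zero.2 (Nat.ceil_pos.2 ha).ne').trans hj
    · rw [sum_logLR] at hcon ⊢
      exact test_all_of_test (hΘ θ hθ).2 hθ₁ hlam (hΘ θ hθ).1 h2
        (han.trans (by exact_mod_cast hj)) hcon
  have hint0 : 0 ≤ ∫ ω, max (n * m - ∑ i ∈ Finset.range n, ω i) 0 ∂P :=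
    integral_nonneg fun ω => le_max_right _ _
  rw [longARL, lintegral_stopping hst]
  refine ENNReal.tsum_le_of_sum_range_le fun M => ?_
  calc ∑ k ∈ Finset.range M, P {ω | (k : ℕ∞) < T ω}
      ≤ ∑ k ∈ Finset.range (n + M), P {ω | (k : ℕ∞) < T ω} :=
        Finset.sum_le_sum_of_subset (Finset.range_mono (by omega))
    _ = ∑ k ∈ Finset.range n, P {ω | (k : ℕ∞) < T ω} +
        ∑ k ∈ Finset.range M, P {ω | ((n + k : ℕ) : ℕ∞) < T ω} := Finset.sum_range_add _ _ _
    _ ≤ n + ∑ k ∈ Finset.range M, ENNReal.ofReal (P.real {ω | ∀ j, n ≤ j → j ≤ n + k →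
        ∑ i ∈ Finset.range j, logLR F lam θ₁ (ω i) < klInfo F lam θ₁ * a}) := by
        refine add_le_add ?_ (Finset.sum_le_sum fun k _ => hsub k)
        simpa using Finset.sum_le_sum fun k (_ : k ∈ Finset.range n) =>
          (prob_le_one : P {ω | (k : ℕ∞) < T ω} ≤ 1)
    _ ≤ _ := by
        rw [← ENNReal.ofReal_sum_of_nonneg fun k _ => measureReal_nonneg,
          ← ENNReal.ofReal_natCast, ← ENNReal.ofReal_add (Nat.cast_nonneg _)
            (Finset.sum_nonneg fun k _ => measureReal_nonneg)]
        refine ENNReal.ofReal_le_ofReal (add_le_add le_rfl ?_)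
        rw [le_div_iff₀ hpos, mul_comm]
        exact (hwald M).trans (add_le_add hdef le_rfl)

end TestMean

/-- Source of the factor `√(b''(lam)/(2π))`; after reflection it is a Gamma integral on the
half-line. -/
theorem integral_negPart_gaussianReal {v : NNReal} (hv : v ≠ 0) :
    ∫ z, max (-z) 0 ∂gaussianReal 0 v = √(v / (2 * Real.pi)) := by
  have hv0 : (0 : ℝ) < v := by exact_mod_cast pos_iff_ne_zero.2 hv
  rw [integral_gaussianReal_eq_integral_smul hv,
    ← integral_neg_eq_self (fun x : ℝ => gaussianPDFReal 0 v x • max (-x) 0)]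
  have h1 : (fun x : ℝ => gaussianPDFReal 0 v (-x) • max (- -x) 0) =
      (Set.Ioi 0).indicator fun x : ℝ => (√(2 * Real.pi * v))⁻¹ *
        (x ^ (1 : ℝ) * Real.exp (-(1 / (2 * v)) * x ^ (2 : ℝ))) := by
    ext x
    by_cases hx : 0 < x
    · rw [Set.indicator_of_mem (Set.mem_Ioi.2 hx), neg_neg, max_eq_left hx.le, gaussianPDFReal,
        Real.rpow_one, Real.rpow_two, smul_eq_mul, mul_assoc, mul_comm x]
      congr 3
      field_simp
      ring
    · rw [Set.indicator_of_notMem (by simpa using hx), neg_neg, max_eq_right (not_lt.1 hx),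
        smul_zero]
  rw [h1, integral_indicator measurableSet_Ioi, integral_const_mul,
    integral_rpow_mul_exp_neg_mul_rpow two_pos (by norm_num) (by positivity)]
  have e1 : (-(1 + 1) / 2 : ℝ) = -1 := by norm_num
  have e2 : ((1 + 1) / 2 : ℝ) = 1 := by norm_num
  rw [e1, e2, Real.Gamma_one, Real.rpow_neg_one]
  have h3 : 0 < √(2 * Real.pi * v) := Real.sqrt_pos.2 (by positivity)
  have h2 : √(v / (2 * Real.pi)) = v / √(2 * Real.pi * v) := by
    rw [eq_div_iff h3.ne', ← Real.sqrt_mul (by positivity),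
      show (v : ℝ) / (2 * Real.pi) * (2 * Real.pi * v) = v ^ 2 by field_simp,
      Real.sqrt_sq hv0.le]
  rw [h2]
  field_simp

/-! ### Central limit theorem and the mean deficit. -/

section CLT

variable {μ : Measure ℝ} [IsProbabilityMeasure μ]

theorem memLp_obs (h2 : MemLp (fun x : ℝ => x) 2 μ) (i : ℕ) :
    MemLp (fun ω : SamplePath => ω i) 2 (Measure.infinitePi fun _ : ℕ => μ) := by
  have h := h2
  rw [← Measure.infinitePi_map_eval (fun _ : ℕ => μ) i] at h
  exact h.comp_of_map (measurable_pi_apply i).aemeasurable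

theorem variance_obs (i : ℕ) :
    Var[fun ω : SamplePath => ω i; Measure.infinitePi fun _ : ℕ => μ] =
      Var[fun x : ℝ => x; μ] := by
  conv_rhs => rw [← Measure.infinitePi_map_eval (fun _ : ℕ => μ) i]
  rw [variance_map (X := fun x : ℝ => x) aemeasurable_id' (measurable_pi_apply i).aemeasurable]
  rfl

theorem variance_sum_obs (h2 : MemLp (fun x : ℝ => x) 2 μ) (n : ℕ) :
    ∫ ω, (∑ i ∈ Finset.range n, ω i - n * ∫ x, x ∂μ) ^ 2 ∂(Measure.infinitePi fun _ : ℕ => μ) =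
      n * Var[fun x : ℝ => x; μ] := by
  set P := Measure.infinitePi fun _ : ℕ => μ
  have hL : ∀ i : ℕ, MemLp (fun ω : SamplePath => ω i) 2 P := memLp_obs h2
  have hind : iIndepFun (fun i (ω : SamplePath) => ω i) P :=
    iIndepFun_infinitePi (P := fun _ => μ) (X := fun _ x => x) fun _ => measurable_id
  have hsum := IndepFun.variance_sum (X := fun i (ω : SamplePath) => ω i)
    (s := Finset.range n) (fun i _ => hL i) fun i _ j _ hij => hind.indepFun hij
  simp only [P, variance_obs, Finset.sum_const, Finset.card_range, nsmul_eq_mul] at hsum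
  rw [← hsum, variance_eq_integral]
  · have hmean : ∫ ω, (∑ i ∈ Finset.range n, fun ω : SamplePath => ω i) ω ∂P = n * ∫ x, x ∂μ := by
      simp only [Finset.sum_apply]
      rw [integral_finsetSum _ fun i _ => (hL i).integrable one_le_two]
      have : ∀ i : ℕ, ∫ ω : SamplePath, ω i ∂P = ∫ x, x ∂μ := fun i =>
        integral_infinitePi_eval (fun _ => μ) i measurable_id
      simp [this]
    rw [hmean]
    simp only [Finset.sum_apply]
    rfl
  · exact Finset.aemeasurable_sum _ fun i _ => (measurable_pi_apply i).aemeasurable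

/-- The central limit theorem for bounded continuous functions of the observations. -/
theorem tendsto_integral_normalized_sum (h2 : MemLp (fun x : ℝ => x) 2 μ) {f : ℝ → ℝ}
    (hfc : Continuous f) {K : ℝ} (hfb : ∀ z, ‖f z‖ ≤ K) :
    Tendsto (fun n : ℕ => ∫ ω : SamplePath,
      f ((√n)⁻¹ * (∑ i ∈ Finset.range n, ω i - n * ∫ x, x ∂μ))
        ∂(Measure.infinitePi fun _ : ℕ => μ)) atTop
      (𝓝 (∫ z, f z ∂gaussianReal 0 Var[fun x : ℝ => x; μ].toNNReal)) := by
  set P := Measure.infinitePi fun _ : ℕ => μ with hP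
  have hind : iIndepFun (fun i (ω : SamplePath) => ω i) P :=
    iIndepFun_infinitePi (P := fun _ => μ) (X := fun _ x => x) fun _ => measurable_id
  have hident : ∀ i : ℕ, IdentDistrib (fun ω : SamplePath => ω i) (fun ω => ω 0) P P := fun i =>
    ⟨(measurable_pi_apply i).aemeasurable, (measurable_pi_apply 0).aemeasurable, by
      rw [hP, Measure.infinitePi_map_eval (fun _ : ℕ => μ) i,
        Measure.infinitePi_map_eval (fun _ : ℕ => μ) 0]⟩
  have hv0 : Var[fun ω : SamplePath => ω 0; P] = Var[fun x : ℝ => x; μ] := variance_obs 0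
  have hm0 : ∫ ω : SamplePath, ω 0 ∂P = ∫ x, x ∂μ :=
    integral_infinitePi_eval (fun _ => μ) 0 measurable_id
  have hlaw : HasLaw (fun x : ℝ => x)
      (gaussianReal 0 Var[fun ω : SamplePath => ω 0; P].toNNReal)
      (gaussianReal 0 Var[fun x : ℝ => x; μ].toNNReal) :=
    ⟨aemeasurable_id, by rw [hv0]; exact Measure.map_id⟩
  have hclt : TendstoInDistribution (fun (n : ℕ) (ω : SamplePath) =>
      (√n)⁻¹ * (∑ i ∈ Finset.range n, ω i - n * ∫ ω : SamplePath, ω 0 ∂P)) atTop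
      (fun x : ℝ => x) (fun _ => P) (gaussianReal 0 Var[fun x : ℝ => x; μ].toNNReal) :=
    tendstoInDistribution_inv_sqrt_mul_sum_sub hlaw (memLp_obs h2 0) hind hident
  rw [hm0] at hclt
  have ht := ProbabilityMeasure.tendsto_iff_forall_integral_tendsto.1 hclt.tendsto
    (BoundedContinuousFunction.ofNormedAddCommGroup f hfc K hfb)
  simp only [BoundedContinuousFunction.coe_ofNormedAddCommGroup, ProbabilityMeasure.coe_mk,
    Measure.map_id'] at ht
  refine ht.congr fun n => ?_
  have hm := hclt.forall_aemeasurable n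
  rw [integral_map hm hfc.aestronglyMeasurable]

/-- Weak convergence handles only bounded functions; the part above `K` is controlled by the second
moment, through `(z + 2K)² ≥ 0`. -/
theorem negPart_le_truncated_add {K : ℝ} (hK : 0 < K) (z : ℝ) :
    max (-z) 0 ≤ min (max (-z) 0) K + z ^ 2 / (4 * K) := by
  have h4 : 0 ≤ z ^ 2 / (4 * K) := by positivity
  rcases le_total (max (-z) 0) K with h | h
  · rw [min_eq_left h]; linarith
  · rw [min_eq_right h]
    have h5 : max (-z) 0 = -z := max_eq_left (by
      rcases le_max_iff.1 h with h | h <;> linarith)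
    rw [h5]
    have : -z - K ≤ z ^ 2 / (4 * K) := by
      rw [le_div_iff₀ (by positivity)]
      nlinarith [sq_nonneg (z + 2 * K)]
    linarith

/-- The mean deficit of a random walk with finite variance below its drift is asymptotically at
most the one of the normal law. -/
theorem eventually_integral_deficit_le (h2 : MemLp (fun x : ℝ => x) 2 μ)
    (hv : 0 < Var[fun x : ℝ => x; μ]) {ε : ℝ} (hε : 0 < ε) :
    ∀ᶠ n : ℕ in atTop, ∫ ω, max (n * (∫ x, x ∂μ) - ∑ i ∈ Finset.range n, ω i) 0
      ∂(Measure.infinitePi fun _ : ℕ => μ) ≤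
        (√(Var[fun x : ℝ => x; μ] / (2 * Real.pi)) + ε) * √n := by
  set P := Measure.infinitePi fun _ : ℕ => μ
  set v := Var[fun x : ℝ => x; μ] with hvdef
  set m := ∫ x, x ∂μ
  -- Makes the tail contribution `v/(4K)` equal to `ε/2`; the other half of `ε` is spent on the weak
  -- limit.
  set K := v / (2 * ε) with hKdef
  have hK : 0 < K := by positivity
  set f : ℝ → ℝ := fun z => min (max (-z) 0) K with hf
  have hfc : Continuous f := by fun_prop
  have hf0 : ∀ z, 0 ≤ f z := fun z => le_min (le_max_right _ _) hK.le
  have hfb : ∀ z, ‖f z‖ ≤ K := fun z => by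
    rw [Real.norm_eq_abs, abs_of_nonneg (hf0 z)]; exact min_le_right _ _
  have ht := tendsto_integral_normalized_sum h2 hfc hfb
  have hvn : v.toNNReal ≠ 0 := (Real.toNNReal_pos.2 hv).ne'
  have hlim : ∫ z, f z ∂gaussianReal 0 v.toNNReal ≤ √(v / (2 * Real.pi)) := by
    have h := integral_negPart_gaussianReal hvn
    rw [Real.coe_toNNReal _ hv.le] at h
    rw [← h]
    have hi : Integrable (fun z : ℝ => z) (gaussianReal 0 v.toNNReal) :=
      (memLp_id_gaussianReal' (μ := 0) (v := v.toNNReal) 1 ENNReal.one_ne_top).integrable le_rfl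
    exact integral_mono_of_nonneg (ae_of_all _ hf0) hi.neg.pos_part
      (ae_of_all _ fun z => min_le_left _ _)
  have hev := ht.eventually (gt_mem_nhds (lt_of_le_of_lt hlim
    (lt_add_of_pos_right _ (half_pos hε))))
  filter_upwards [hev, eventually_gt_atTop 0] with n hn hn0
  set Z : SamplePath → ℝ := fun ω => (√n)⁻¹ * (∑ i ∈ Finset.range n, ω i - n * m) with hZ
  have hZm : Measurable Z := by
    have : Measurable fun ω : SamplePath => ∑ i ∈ Finset.range n, ω i :=
      Finset.measurable_sum _ fun i _ => measurable_pi_apply i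
    exact (this.sub_const _).const_mul _
  have hsn : 0 < √(n : ℝ) := Real.sqrt_pos.2 (by exact_mod_cast hn0)
  have hsq : √(n : ℝ) ^ 2 = n := Real.sq_sqrt (Nat.cast_nonneg n)
  have hZL : MemLp Z 2 P := by
    have := memLp_finsetSum (Finset.range n) fun i _ => memLp_obs h2 i
    exact (this.sub (memLp_const (n * m))).const_mul _
  have hZ2 : ∫ ω, Z ω ^ 2 ∂P = v := by
    simp only [hZ, mul_pow]
    rw [integral_const_mul, variance_sum_obs h2, inv_pow, hsq, inv_mul_cancel_left₀]
    exact Nat.cast_ne_zero.2 hn0.ne'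
  have hpt : ∀ ω, max (n * m - ∑ i ∈ Finset.range n, ω i) 0 ≤
      √n * (f (Z ω) + Z ω ^ 2 / (4 * K)) := by
    intro ω
    have e : max (n * m - ∑ i ∈ Finset.range n, ω i) 0 = √n * max (-Z ω) 0 := by
      rw [mul_max_of_nonneg _ _ hsn.le, mul_zero, mul_neg, hZ, mul_inv_cancel_left₀ hsn.ne',
        neg_sub]
    rw [e]
    exact mul_le_mul_of_nonneg_left (negPart_le_truncated_add hK _) hsn.le
  have hfi : Integrable (fun ω => f (Z ω)) P :=
    Integrable.of_bound (hfc.measurable.comp hZm).aestronglyMeasurable K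
      (ae_of_all _ fun ω => hfb _)
  have hi : Integrable (fun ω => Z ω ^ 2 / (4 * K)) P := hZL.integrable_sq.div_const (4 * K)
  have hle : ∫ ω, max (n * m - ∑ i ∈ Finset.range n, ω i) 0 ∂P ≤
      ∫ ω, √n * (f (Z ω) + Z ω ^ 2 / (4 * K)) ∂P :=
    integral_mono_of_nonneg (ae_of_all _ fun ω => le_max_right _ _)
      ((hfi.add hi).const_mul (√n)) (ae_of_all P hpt)
  refine hle.trans ?_
  rw [integral_const_mul, integral_add hfi hi, integral_div, hZ2, mul_comm]
  refine mul_le_mul_of_nonneg_right ?_ hsn.le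
  have : v / (4 * K) = ε / 2 := by
    rw [hKdef]; field_simp; norm_num
  rw [this]
  linarith [hn]

end CLT

/-! ### Error terms of order `o(√a)`. -/

section Asymptotics

variable {F : Measure ℝ} [NeZero F] {lam θ₁ : ℝ}

theorem delayConst_pos (hθ₁ : Integrable (fun x => Real.exp (θ₁ * x)) F)
    (hlam : lam ∈ interior (integrableExpSet id F)) (h2 : θ₁ < lam)
    (hnd : ∀ c : ℝ, ¬ ∀ᵐ x ∂F, x = c) : 0 < delayConst F lam θ₁ := by
  have := klInfo_pos hlam hθ₁ h2 hnd
  have := variance_pos hlam hnd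
  have := sub_pos.2 h2
  unfold delayConst
  positivity

theorem eventually_longARL_openEndedTest_le {Θ : Set ℝ}
    (hθ₁ : θ₁ ∈ interior (integrableExpSet id F))
    (hlam : lam ∈ interior (integrableExpSet id F)) (h2 : θ₁ < lam)
    (hnd : ∀ c : ℝ, ¬ ∀ᵐ x ∂F, x = c)
    (hΘ : ∀ θ ∈ Θ, θ ≤ θ₁ ∧ Integrable (fun x => Real.exp (θ * x)) F) {ε : ℝ} (hε : 0 < ε) :
    ∀ᶠ a in atTop, longARL F lam (openEndedTest F lam Θ a) ≤
      ENNReal.ofReal (a + (delayConst F lam θ₁ + ε) * √a) := by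
  have hprob := isProbabilityMeasure_obsLaw (integrable_exp_of_mem_interior hlam)
  have hI := klInfo_pos hlam (integrable_exp_of_mem_interior hθ₁) h2 hnd
  have hC := delayConst_pos (integrable_exp_of_mem_interior hθ₁) hlam h2 hnd
  have hd := sub_pos.2 h2
  set v := iteratedDeriv 2 (logNorm F) lam with hv
  have hvpos : 0 < v := variance_pos hlam hnd
  set s := √(v / (2 * Real.pi)) with hs
  set J : ℕ → ℝ := fun K => ∫ x, min (logLR F lam θ₁ x) K ∂obsLaw F lam with hJ
  have hJt : Tendsto J atTop (𝓝 (klInfo F lam θ₁)) :=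
    tendsto_integral_min (integrable_logLR hlam θ₁)
  -- A single integer `K` serves as the cap of the increments and, through `1/(K+1)`, as the
  -- tolerance in the central limit theorem.
  have hCt : Tendsto (fun K : ℕ => (lam - θ₁) * (s + 1 / ((K : ℝ) + 1)) / J K) atTop
      (𝓝 (delayConst F lam θ₁)) := by
    have h := ((tendsto_one_div_add_atTop_nhds_zero_nat (𝕜 := ℝ)).const_add s).const_mul (lam - θ₁)
    have h' := h.div hJt hI.ne'
    have e : (lam - θ₁) * (s + 0) / klInfo F lam θ₁ = delayConst F lam θ₁ := by
      rw [delayConst, ← hv, ← hs]; ring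
    rwa [e] at h'
  obtain ⟨K, hK1, hK2⟩ := ((hCt.eventually (gt_mem_nhds
    (lt_add_of_pos_right (delayConst F lam θ₁) (half_pos hε)))).and
    (hJt.eventually (lt_mem_nhds hI))).exists
  set δ : ℝ := 1 / ((K : ℝ) + 1) with hδ
  have hδ0 : 0 < δ := by positivity
  have hdef := eventually_integral_deficit_le (μ := obsLaw F lam)
    (by simpa using memLp_obsLaw hlam 2) (by rw [variance_obsLaw hlam]; exact hvpos) hδ0
  rw [variance_obsLaw hlam, ← hv, ← hs] at hdef
  set C := delayConst F lam θ₁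
  -- The bounded errors: `1` from `⌈a⌉ ≤ a + 1`, `C + ε/2` from `√⌈a⌉ ≤ √a + 1`, and `K / J K` from
  -- the overshoot.
  have hbig : ∀ᶠ a : ℝ in atTop, 1 + (C + ε / 2) + K / J K ≤ ε / 2 * √a := by
    have := (Real.tendsto_sqrt_atTop.const_mul_atTop (half_pos hε))
    exact this.eventually_ge_atTop _
  filter_upwards [(tendsto_nat_ceil_atTop (α := ℝ)).eventually hdef, hbig,
    eventually_ge_atTop 1] with a ha1 ha2 ha3
  have ha0 : 0 < a := by linarith
  refine (longARL_openEndedTest_le hθ₁ hlam h2 hΘ ha0 (Nat.cast_nonneg K) hK2).trans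
    (ENNReal.ofReal_le_ofReal ?_)
  have hceil : (⌈a⌉₊ : ℝ) ≤ a + 1 := (Nat.ceil_lt_add_one ha0.le).le
  have hsqrt : √(⌈a⌉₊ : ℝ) ≤ √a + 1 := by
    have h1 : 0 ≤ √a := Real.sqrt_nonneg a
    refine Real.sqrt_le_iff.2 ⟨by linarith, ?_⟩
    nlinarith [Real.sq_sqrt ha0.le]
  set e := ∫ ω, max (⌈a⌉₊ * (∫ x, x ∂obsLaw F lam) - ∑ i ∈ Finset.range ⌈a⌉₊, ω i) 0
        ∂noChangeLaw F lam
  have he : e ≤ (s + δ) * √(⌈a⌉₊ : ℝ) := ha1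
  change (⌈a⌉₊ : ℝ) + ((lam - θ₁) * e + K) / J K ≤ _
  have h5 : (lam - θ₁) * e / J K ≤ (C + ε / 2) * (√a + 1) := by
    calc (lam - θ₁) * e / J K ≤ (lam - θ₁) * ((s + δ) * √(⌈a⌉₊ : ℝ)) / J K := by gcongr
      _ = (lam - θ₁) * (s + δ) / J K * √(⌈a⌉₊ : ℝ) := by ring
      _ ≤ (C + ε / 2) * (√a + 1) := by gcongr
  rw [add_div]
  linarith

/-- A family of upper bounds, one for each `ε`, gives a single error term that tends to `0`. -/
theorem exists_tendsto_zero_of_forall_eventually_le {V : ℝ → ℝ≥0∞} {C : ℝ}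
    (h : ∀ ε : ℝ, 0 < ε → ∀ᶠ a in atTop, V a ≤ ENNReal.ofReal (a + (C + ε) * √a)) (hC : 0 ≤ C) :
    ∃ r : ℝ → ℝ, Tendsto r atTop (𝓝 0) ∧ (∀ a, 0 ≤ r a) ∧
      ∀ᶠ a in atTop, V a ≤ ENNReal.ofReal (a + (C + r a) * √a) := by
  -- The normalized excess of `V` itself, clipped at `0`, is the error term, so no choice of `ε`
  -- depending on `a` is needed.
  refine ⟨fun a => max (((V a).toReal - a) / √a - C) 0, ?_, fun a => le_max_right _ _, ?_⟩
  · refine tendsto_order.2 ⟨fun x hx => Eventually.of_forall fun a =>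
      hx.trans_le (le_max_right _ _), fun x hx => ?_⟩
    filter_upwards [h (x / 2) (half_pos hx), eventually_gt_atTop 0] with a h1 h2
    have hs : 0 < √a := Real.sqrt_pos.2 h2
    have h3 : (V a).toReal ≤ a + (C + x / 2) * √a :=
      ENNReal.toReal_le_of_le_ofReal (by positivity) h1
    refine max_lt ?_ hx
    have : ((V a).toReal - a) / √a ≤ C + x / 2 := by
      rw [div_le_iff₀ hs]; linarith
    linarith
  · filter_upwards [h 1 one_pos, eventually_gt_atTop 0] with a h1 h2
    have hs : 0 < √a := Real.sqrt_pos.2 h2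
    have hne : V a ≠ ⊤ := ne_top_of_le_ne_top ENNReal.ofReal_ne_top h1
    rw [← ENNReal.ofReal_toReal hne]
    refine ENNReal.ofReal_le_ofReal ?_
    rw [ENNReal.ofReal_toReal hne]
    have h4 := mul_le_mul_of_nonneg_right
      (le_max_left (((V a).toReal - a) / √a - C) 0) hs.le
    rw [sub_mul, div_mul_cancel₀ _ hs.ne'] at h4
    linarith

theorem tendsto_log_div_sqrt {f : ℝ → ℝ} {C : ℝ} (hf : ∀ᶠ a in atTop, 1 ≤ f a ∧ f a ≤ C * a) :
    Tendsto (fun a => Real.log (f a) / √a) atTop (𝓝 0) := by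
  have h1 : Tendsto (fun a : ℝ => Real.log C / √a + Real.log a / √a) atTop (𝓝 0) := by
    have h2 := (Real.tendsto_sqrt_atTop).const_div_atTop (Real.log C)
    have h3 := (isLittleO_log_rpow_atTop (r := 1 / 2) (by norm_num)).tendsto_div_nhds_zero
    simp only [← Real.sqrt_eq_rpow] at h3
    simpa using h2.add h3
  refine tendsto_of_tendsto_of_tendsto_of_le_of_le' tendsto_const_nhds h1 ?_ ?_
  · filter_upwards [hf] with a ha
    exact div_nonneg (Real.log_nonneg ha.1) (Real.sqrt_nonneg _)
  · filter_upwards [hf, eventually_gt_atTop 0] with a ha ha0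
    have hC : 0 < C := by
      by_contra! hC
      have := mul_nonpos_of_nonpos_of_nonneg hC ha0.le
      linarith
    rw [← add_div, ← Real.log_mul hC.ne' ha0.ne']
    exact div_le_div_of_nonneg_right (Real.log_le_log (by linarith) ha.2) (Real.sqrt_nonneg _)

end Asymptotics

/-- The excess of the information bound over its main term is of smaller order than `√a`. -/
theorem tendsto_information_excess {r : ℝ → ℝ} (hr : Tendsto r atTop (𝓝 0))
    (hr0 : ∀ a, 0 ≤ r a) {C I : ℝ} (hC : 0 ≤ C) :
    Tendsto (fun a => r a +
      (2 * I + 5 + 2 * Real.log (a + (C + r a) * √a)) / (I * √a)) atTop (𝓝 0) := by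
  have h1 : ∀ᶠ a in atTop, 1 ≤ a + (C + r a) * √a ∧ a + (C + r a) * √a ≤ (C + 2) * a := by
    filter_upwards [hr.eventually (gt_mem_nhds one_pos), eventually_ge_atTop 1] with a ha1 ha2
    have hs : 0 ≤ √a := Real.sqrt_nonneg a
    have hsa : √a ≤ a := Real.sqrt_le_iff.2 ⟨by linarith, by nlinarith⟩
    have h0 := hr0 a
    have h3 : (C + r a) * √a ≤ (C + 1) * a :=
      mul_le_mul (by linarith) hsa hs (by linarith)
    have h4 : 0 ≤ (C + r a) * √a := by positivity
    constructor <;> linarith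
  have h2 := (tendsto_log_div_sqrt h1).const_mul (2 / I)
  have h3 := Real.tendsto_sqrt_atTop.const_div_atTop ((2 * I + 5) / I)
  have h4 := (hr.add h3).add h2
  simp only [add_zero, mul_zero] at h4
  refine h4.congr fun a => ?_
  rw [div_div, div_mul_div_comm, add_assoc, ← add_div]

end ExpFamilyChange

theorem theorem2p3 (F : Measure ℝ) [SigmaFinite F] (lo hi : EReal)
    (hΩ : ∀ ξ : ℝ, Integrable (fun x : ℝ => Real.exp (ξ * x)) F ↔
      lo < (ξ : EReal) ∧ (ξ : EReal) < hi)
    (hmean : Tendsto (fun θ : ℝ => ∫ x, x ∂(obsLaw F θ))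
      (comap Real.toEReal (𝓝[>] lo)) atBot)
    (θ₁ lam : ℝ) (hlo : lo < (θ₁ : EReal)) (hlt : θ₁ < lam) (hhi : (lam : EReal) < hi) :
    -- each `detection F lam (halfOpen lo θ₁) a` is a stopping time
    (∀ a : ℝ, 0 < a →
      IsStoppingTime obsFiltration (detection F lam (halfOpen lo θ₁) a)) ∧
    -- lower bound for the long average run lengths
    (∀ a : ℝ, 0 < a → ∀ θ ∈ halfOpen lo θ₁,
      ENNReal.ofReal (Real.exp (klInfo F lam θ * a)) ≤
        longARL F θ (detection F lam (halfOpen lo θ₁) a)) ∧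
    -- upper bound for the worst case detection delay, with a positive constant
    0 < delayConst F lam θ₁ ∧
    (∃ r : ℝ → ℝ, Tendsto r atTop (𝓝 0) ∧ ∀ᶠ a in atTop, ∀ θ' ∈ halfOpen lo θ₁,
      worstDelay F θ' lam (detection F lam (halfOpen lo θ₁) a) ≤
        ENNReal.ofReal (a + (delayConst F lam θ₁ + r a) * √a)) ∧
    -- optimality among all stopping times whose worst case delay is not larger
    (∀ θ ∈ halfOpen lo θ₁,
      (∃ r : ℝ → ℝ, Tendsto r atTop (𝓝 0) ∧ ∀ᶠ a in atTop, ∀ θ' ∈ halfOpen lo θ₁,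
        ∀ N : SamplePath → ℕ∞, IsStoppingTime obsFiltration N →
          worstDelay F θ' lam N ≤ worstDelay F θ' lam (detection F lam (halfOpen lo θ₁) a) →
          ENNReal.log (longARL F θ N) / ((klInfo F lam θ : ℝ) : EReal) ≤
            ((a + (delayConst F lam θ₁ + r a) * √a : ℝ) : EReal)) ∧
      (∃ K : ℝ, ∀ᶠ a in atTop, ∀ θ' ∈ halfOpen lo θ₁,
        ∀ N : SamplePath → ℕ∞, IsStoppingTime obsFiltration N →
          worstDelay F θ' lam N ≤ worstDelay F θ' lam (detection F lam (halfOpen lo θ₁) a) →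
          ENNReal.log (longARL F θ N) ≤
            ENNReal.log (longARL F θ (detection F lam (halfOpen lo θ₁) a)) +
              ((K * √a : ℝ) : EReal))) := by
  have hne := neZero_of_mean hmean hlo
  have hlt' : (θ₁ : EReal) < lam := EReal.coe_lt_coe_iff.2 hlt
  have hint₁ := mem_interior_integrableExpSet hΩ hlo (hlt'.trans hhi)
  have hintl := mem_interior_integrableExpSet hΩ (hlo.trans hlt') hhi
  have hexpl := integrable_exp_of_mem_interior hintl
  have hnd := not_ae_eq_const hΩ hmean hlo (hlt'.trans hhi)
  have hΘ : ∀ θ ∈ halfOpen lo θ₁, θ ≤ θ₁ ∧ Integrable (fun x => Real.exp (θ * x)) F :=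
    fun θ hθ => ⟨hθ.2, (hΩ θ).2 ⟨hθ.1,
      (EReal.coe_le_coe_iff.2 hθ.2).trans_lt (hlt'.trans hhi)⟩⟩
  have hprobl := isProbabilityMeasure_obsLaw hexpl
  have hC := delayConst_pos (integrable_exp_of_mem_interior hint₁) hintl hlt hnd
  have hARL : ∀ a : ℝ, ∀ θ ∈ halfOpen lo θ₁,
      ENNReal.ofReal (Real.exp (klInfo F lam θ * a)) ≤
        longARL F θ (detection F lam (halfOpen lo θ₁) a) := fun a θ hθ =>
    exp_le_longARL_detection hexpl (hΘ θ hθ).2 hθ a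
  -- This error term comes from the mean of the test under `lam`, which does not involve `θ'`; hence
  -- the delay bound is uniform in `θ'`.
  obtain ⟨r, hr, hr0, hrV⟩ := exists_tendsto_zero_of_forall_eventually_le
    (fun ε hε => eventually_longARL_openEndedTest_le hint₁ hintl hlt hnd hΘ hε) hC.le
  set C := delayConst F lam θ₁
  have hdelay : ∀ᶠ a in atTop, ∀ θ' ∈ halfOpen lo θ₁,
      worstDelay F θ' lam (detection F lam (halfOpen lo θ₁) a) ≤
        ENNReal.ofReal (a + (C + r a) * √a) := by
    filter_upwards [hrV] with a ha θ' hθ'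
    have := isProbabilityMeasure_obsLaw (hΘ θ' hθ').2
    exact (worstDelay_detection_le _ a).trans ha
  refine ⟨fun a _ => isStoppingTime_detection F lam _ a, fun a _ => hARL a, hC,
    ⟨r, hr, hdelay⟩, fun θ hθ => ?_⟩
  have hprob := isProbabilityMeasure_obsLaw (hΘ θ hθ).2
  have hI := klInfo_pos hintl (hΘ θ hθ).2 (hθ.2.trans_lt hlt) hnd
  set I := klInfo F lam θ with hIdef
  -- With `B = a + (C + r a)√a`, this is chosen so that `I * (a + (C + r' a)√a)` equals the exponent
  -- `I * B + (2I + 5 + 2 log B)` of `longARL_le_of_worstDelay_le`.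
  set r' : ℝ → ℝ := fun a => r a +
      (2 * I + 5 + 2 * Real.log (a + (C + r a) * √a)) / (I * √a) with hr'def
  have hr' : Tendsto r' atTop (𝓝 0) := tendsto_information_excess hr hr0 hC.le
  have hmain : ∀ᶠ a in atTop, ∀ θ' ∈ halfOpen lo θ₁,
      ∀ N : SamplePath → ℕ∞, IsStoppingTime obsFiltration N →
        worstDelay F θ' lam N ≤ worstDelay F θ' lam (detection F lam (halfOpen lo θ₁) a) →
        ENNReal.log (longARL F θ N) ≤ ((I * (a + (C + r' a) * √a) : ℝ) : EReal) := by
    filter_upwards [hdelay, eventually_ge_atTop 2] with a ha ha2 θ' hθ' N hN hle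
    have := isProbabilityMeasure_obsLaw (hΘ θ' hθ').2
    have hs : 0 < √a := Real.sqrt_pos.2 (by linarith)
    have h1 : 0 ≤ (C + r a) * √a := mul_nonneg (add_nonneg hC.le (hr0 a)) hs.le
    have h2 := longARL_le_of_worstDelay_le (integrable_logLR hintl θ) hI.le hN
      (by linarith : 2 ≤ a + (C + r a) * √a) (hle.trans (ha θ' hθ'))
    refine (ENNReal.log_monotone h2).trans (le_of_eq ?_)
    rw [ENNReal.log_ofReal_of_pos (Real.exp_pos _), Real.log_exp, ← hIdef]
    congr 1
    simp only [hr'def]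
    field_simp
    ring
  -- Eventually `r' a < 1`, and `I * a` is a lower bound for the logarithm of the detection rule's
  -- own run length, so `I * (C + 1)` suffices for `K`.
  refine ⟨⟨r', hr', ?_⟩, ⟨I * (C + 1), ?_⟩⟩
  · filter_upwards [hmain] with a ha θ' hθ' N hN hle
    rw [EReal.div_le_iff_le_mul (EReal.coe_pos.2 hI) (EReal.coe_ne_top _), ← EReal.coe_mul]
    exact ha θ' hθ' N hN hle
  · filter_upwards [hmain, hr'.eventually (gt_mem_nhds one_pos)] with a ha h1 θ' hθ' N hN hle
    refine (ha θ' hθ' N hN hle).trans ?_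
    have h2 := ENNReal.log_monotone (hARL a θ hθ)
    rw [ENNReal.log_ofReal_of_pos (Real.exp_pos _), Real.log_exp, ← hIdef] at h2
    refine le_trans ?_ (add_le_add h2 le_rfl)
    rw [← EReal.coe_add, EReal.coe_le_coe_iff]
    have h3 := mul_le_mul_of_nonneg_right h1.le (Real.sqrt_nonneg a)
    have h4 := mul_le_mul_of_nonneg_left h3 hI.le
    linarith
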